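/- **Setting.** Fix $M, J, T, d, d_Y\in\mathbb N$, finite sets $\mathcal X$ (states) and $\mathcal A$ (actions), and $1\le q\le\infty$. The data are i.i.d. market histories $W_i=(x_{it},(a_{jit})_{j\le J})_{t\le T}$, $i=1,2,\dots$, with values in $(\mathcal X\times\mathcal A^J)^T$. Let $\Theta\subset\mathbb R^{d}$ be compact, $\mathcal Y\subseteq\mathbb R^{d_Y}$, and let $\mathcal P$ be a compact set of conditional-choice-probability profiles $P=(P_j(a|x))$. Let $G(\theta,\tilde\theta,Y,P)$ be a fixed-point map and $\Gamma^q(\theta,\tilde\theta,P;Y)\in\mathcal Y$ an inner algorithm. Let $\Lambda_j(\theta,Y,P)(a|x)=\exp v_j(x,a;\theta,Y,P)/\sum_{a'}\exp v_j(x,a';\theta,Y,P)$ be the logit map of given conditional value functions $v_j$, and put $\Lambda^q(\theta,\tilde\theta,Y,P)=\Lambda(\theta,\Gamma^q(\theta,\tilde\theta,P;Y),P)$. Bold letters stack the types $m=1,\dots,M$, and all maps act type by type. The mixture likelihood and pseudo-likelihoods are $$f(W;\boldsymbol\theta,\boldsymbol\pi;\tilde{\boldsymbol\theta},\mathbf Y,\mathbf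 P)=\sum_m\pi_m\prod_{t,j}\Lambda^q_j(\theta^m,\tilde\theta^m,Y^m,P^m)(a_{jt}|x_t),\qquad Q^q_N=\frac1N\sum_{i\le N}\log f(W_i;\cdot),\quad Q^q=\mathbb E\log f(W_1;\cdot).$$ The sample (population) EM-NPL($q$) fixed points are the $(\boldsymbol\pi,\boldsymbol\theta,\mathbf Y,\mathbf P)$ with $Y^m\in\mathcal Y$, $P^m\in\mathcal P$ such that $(\boldsymbol\theta,\boldsymbol\pi)$ maximizes $Q_N^q(\cdot;\boldsymbol\theta,\mathbf Y,\mathbf P)$ (respectively $Q^q(\cdot;\boldsymbol\theta,\mathbf Y,\mathbf P)$) over $\Theta^M\times\Delta^{M-1}$, $Y^m=\Gamma^q(\theta^m,\theta^m,P^m;Y^m)$ and $P^m=\Lambda(\theta^m,Y^m,P^m)$. An EM-NPL($q$) estimator maximizes $Q^q_N(\boldsymbol\theta,\boldsymbol\pi;\boldsymbol\theta,\mathbf Y,\mathbf P)$ over the sample fixed points. With $w_{m}(\mathbf P,\boldsymbol\pi)(W)=\pi_m\prod_{t,j}P^m_j(a_{jt}|x_t)\big/\sum_{m'}\pi_{m'}\prod_{t,j}P^{m'}_j(a_{jt}|x_t)$,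 one iteration of the EM-NPL($q$) algorithm is: $\pi_m^{(k)}=\frac1N\sum_i w_{im}^{(k)}$ with $w^{(k)}_{im}=w_m(\mathbf P^{(k-1)},\boldsymbol\pi^{(k-1)})(W_i)$; $\theta^{m,(k)}$ is a maximizer over $\theta^m\in\Theta$ of $\sum_i w_{im}^{(k)}\sum_{t,j}\log\Lambda_j^q(\theta^m,\theta^{m,(k-1)},Y^{m,(k-1)},P^{m,(k-1)})(a_{jit}|x_{it})$; then $Y^{m,(k)}=\Gamma^q(\theta^{m,(k)},\theta^{m,(k-1)},P^{m,(k-1)};Y^{m,(k-1)})$ and $P^{m,(k)}=\Lambda(\theta^{m,(k)},Y^{m,(k)},P^{m,(k-1)})$. Put $$E(\boldsymbol\pi,\mathbf P)=\mathbb E[(w_m(\mathbf P,\boldsymbol\pi))_m],\qquad \ell_E^q(\boldsymbol\theta;\tilde{\boldsymbol\theta},\mathbf Y,\mathbf P,\boldsymbol\pi)=\sum_m\mathbb E\Big[w_m(\mathbf P,\boldsymbol\pi)\sum_{t,j}\log\Lambda^q_j(\theta^m,\tilde\theta^m,Y^m,P^m)(a_{jt}|x_t)\Big].$$ **Assumptions.**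 Let $s^*=(\boldsymbol\pi^*,\boldsymbol\theta^*,\mathbf Y^*,\mathbf P^*)$ be a population fixed point. 1. For all $(\theta,\tilde\theta,P)\in\Theta^2\times\mathcal P$, $Y=G(\theta,\tilde\theta,Y,P)$ has a unique solution in $\mathcal Y$, it depends continuously on $(\theta,\tilde\theta,P)$, and it is the unique fixed point of $\Gamma^q(\theta,\tilde\theta,P;\cdot)$ in $\mathcal Y$. 2. $s^*$ maximizes $Q^q(\boldsymbol\theta,\boldsymbol\pi;\boldsymbol\theta,\mathbf Y,\mathbf P)$ over the population fixed points, uniquely up to label permutation, and is an isolated population fixed point. 3. $\theta^{m*}\in\operatorname{int}\Theta$, $\pi^*_m>0$, $Y^{m*}\in\operatorname{int}\mathcal Y$, and $\mathcal P$ is a neighbourhood of $P^{m*}$ relative to the set of all choice-probability profiles. On their domains, $G$ is $C^2$ and $\Gamma^q$, $\Lambda$ are $C^3$ (as restrictions of maps smooth near each point of the domain). 4. $\nabla^2_{(\boldsymbol\theta,\boldsymbol\pi)}Q^q$ at $s^*$ is negative definite on increments with $\sum_m d\pi_m=0$. 5. For $z$ in a neighbourhood $V$ of $z^*=(\boldsymbol\theta^*,\mathbf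 Y^*,\mathbf P^*)$, the global maximizer of $Q^q(\cdot;z)$ is unique up to those label permutations of $(\boldsymbol\theta,\boldsymbol\pi)$ that leave $f(W;\cdot;z')$ invariant for all $W$ and all $z'\in V$. 6. There is a choice $\boldsymbol\alpha(z)$ of a global maximizer for $z$ near $z^*$, continuous at $z^*$ with $\boldsymbol\alpha(z^*)=(\boldsymbol\theta^*,\boldsymbol\pi^*)$, such that $\phi_q(\tilde{\boldsymbol\theta},\mathbf Y,\mathbf P)=(\boldsymbol\theta,\mathbf Y',\Lambda(\boldsymbol\theta,\mathbf Y',\mathbf P))$, with $\boldsymbol\theta$ the $\boldsymbol\theta$-component of $\boldsymbol\alpha(\tilde{\boldsymbol\theta},\mathbf Y,\mathbf P)$ and $\mathbf Y'=\Gamma^q(\boldsymbol\theta,\tilde{\boldsymbol\theta},\mathbf P;\mathbf Y)$, is differentiable at $z^*$ and $\phi_q-\mathrm{id}$ has a nonsingular Jacobian there. 7. For each $m$, $\begin{pmatrix}I-\Gamma^q_Y&-\Gamma^q_P\\-\Lambda_Y&I-\Lambda_P\end{pmatrix}$ is invertible at $(\theta^{m*},Y^{m*},P^{m*})$. 8.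 The M-step Hessian $\nabla^2_{\boldsymbol\theta\boldsymbol\theta}\ell^q_E$ is nonsingular at $s^*$. Let $\hat s_N=(\hat{\boldsymbol\pi},\hat{\boldsymbol\theta},\hat{\mathbf Y},\hat{\mathbf P})$ be, with probability tending to one, an EM-NPL($q$) estimator, with its types labelled so that it is at least as close to $s^*$ as any of its relabellings. (For each $k$, the iterates need be produced by the algorithm only with probability tending to one.) **Proposition (Local Convergence of EM-NPL($q$)).** Let $\delta^{(k)}=(\boldsymbol\pi^{(k)},\boldsymbol\theta^{(k)},\mathbf Y^{(k)},\mathbf P^{(k)})-\hat s_N$. If the initial values satisfy $(\boldsymbol\pi^{(0)},\boldsymbol\theta^{(0)},\mathbf Y^{(0)},\mathbf P^{(0)})-s^*=o_p(1)$, then for every $k\ge1$ $$\delta^{(k)}=R^q\,\delta^{(k-1)}+O_p\big(N^{-1/2}\|\delta^{(k-1)}\|+\|\delta^{(k-1)}\|^2\big),$$ $$R^q=\begin{pmatrix}E_{\boldsymbol\pi}&0&0&E_{\mathbf P}\\ H^q_{\boldsymbol\pi}&H^q_{\tilde{\boldsymbol\theta}}&H^q_{\mathbf Y}&H^q_{\mathbf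 P}\\ \Gamma^q_{\boldsymbol\theta}H^q_{\boldsymbol\pi}&\Gamma^q_{\boldsymbol\theta}H^q_{\tilde{\boldsymbol\theta}}+\Gamma^q_{\tilde{\boldsymbol\theta}}&\Gamma^q_{\boldsymbol\theta}H^q_{\mathbf Y}+\Gamma^q_{\mathbf Y}&\Gamma^q_{\boldsymbol\theta}H^q_{\mathbf P}+\Gamma^q_{\mathbf P}\\ \Lambda^q_{\boldsymbol\theta}H^q_{\boldsymbol\pi}&\Lambda^q_{\boldsymbol\theta}H^q_{\tilde{\boldsymbol\theta}}+\Lambda^q_{\tilde{\boldsymbol\theta}}&\Lambda^q_{\boldsymbol\theta}H^q_{\mathbf Y}+\Lambda^q_{\mathbf Y}&\Lambda^q_{\boldsymbol\theta}H^q_{\mathbf P}+\Lambda^q_{\mathbf P}\end{pmatrix},$$ where all blocks are evaluated at $s^*$, subscripts denote partial derivatives (those of $\Gamma^q$ and $\Lambda^q$ being block-diagonal across types), and $H^q_u=-(\nabla^2_{\boldsymbol\theta\boldsymbol\theta}\ell_E^q)^{-1}\nabla^2_{\boldsymbol\theta u}\ell_E^q$ for $u\in\{\boldsymbol\pi,\tilde{\boldsymbol\theta},\mathbf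 Y,\mathbf P\}$. Moreover the expansion holds uniformly near the estimator: there is $r>0$ such that for every $\varepsilon>0$ there is $C$ such that for all large $N$, with probability at least $1-\varepsilon$, every state $s$ with $\|s-\hat s_N\|\le r$ and every result $s'$ of one iteration from $s$ satisfy $\|(s'-\hat s_N)-R^q(s-\hat s_N)\|\le C(N^{-1/2}\|s-\hat s_N\|+\|s-\hat s_N\|^2)$. (Probabilities of possibly non-measurable events are outer probabilities.) -/

import Mathlib

open Filter Topology MeasureTheory ProbabilityTheory

noncomputable section

namespace EMNPL

/-- Profiles `P_j(a|x)` of conditional choice probabilities, as points of a Euclidean space. -/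
abbrev CCP (J : ℕ) (X A : Type*) := Fin J → X → A → ℝ

/-- The observed history `(x_t, (a_{jt})_j)_t` of one market. -/
abbrev Path (T J : ℕ) (X A : Type*) := Fin T → X × (Fin J → A)

/-- `α = (θ, π)`: type-specific structural parameters and mixing weights. -/
abbrev Params (M d : ℕ) := (Fin M → Fin d → ℝ) × (Fin M → ℝ)

/-- `z = (θ, Y, P)`, stacked over the types. -/
abbrev Aux (M d dY J : ℕ) (X A : Type*) :=
  (Fin M → Fin d → ℝ) × (Fin M → Fin dY → ℝ) × (Fin M → CCP J X A)

/-- A state `(π, θ, Y, P)` of the algorithm, stacked over the types. -/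
abbrev State (M d dY J : ℕ) (X A : Type*) := (Fin M → ℝ) × Aux M d dY J X A

/-- Profiles whose values `P_j(·|x)` are probability vectors. -/
def ccpSet (J : ℕ) (X A : Type*) [Fintype A] : Set (CCP J X A) :=
  {P | ∀ j x, P j x ∈ stdSimplex ℝ A}

/-- The primitives of a (finite-state) dynamic discrete choice estimation problem:
parameter spaces for `θ`, `Y`, `P`; the fixed-point map `G(θ, θ', Y, P)`; the inner algorithm
`Γ^q(θ, θ', P; Y)` (`q = ⊤` is allowed); and the conditional value functions
`v_j(x, a; θ, Y, P)` that enter the logit formula. -/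
structure Model (d dY J : ℕ) (X A : Type*) where
  Θset : Set (Fin d → ℝ)
  Yset : Set (Fin dY → ℝ)
  Pset : Set (CCP J X A)
  G : (Fin d → ℝ) → (Fin d → ℝ) → (Fin dY → ℝ) → CCP J X A → (Fin dY → ℝ)
  Γ : ℕ∞ → (Fin d → ℝ) → (Fin d → ℝ) → CCP J X A → (Fin dY → ℝ) → (Fin dY → ℝ)
  v : (Fin d → ℝ) → (Fin dY → ℝ) → CCP J X A → Fin J → X → A → ℝ

section Maps

variable {M d dY J T : ℕ} {X A : Type*} [Fintype X] [Fintype A]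

/-- The CCP map `Λ(θ, Y, P)`: the logit formula. -/
def Model.Λ (S : Model d dY J X A) (θ : Fin d → ℝ) (Y : Fin dY → ℝ) (P : CCP J X A) :
    CCP J X A :=
  fun j x a => Real.exp (S.v θ Y P j x a) / ∑ a', Real.exp (S.v θ Y P j x a')

/-- `Λ^q(θ, θ', Y, P) = Λ(θ, Γ^q(θ, θ', P; Y), P)`. -/
def Model.Λq (S : Model d dY J X A) (q : ℕ∞) (θ θ' : Fin d → ℝ) (Y : Fin dY → ℝ)
    (P : CCP J X A) : CCP J X A :=
  S.Λ θ (S.Γ q θ θ' P Y) P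

/-- `∏_t ∏_j P_j(a_{jt}|x_t)`. -/
def choiceProb (P : CCP J X A) (w : Path T J X A) : ℝ :=
  ∏ t, ∏ j, P j (w t).1 ((w t).2 j)

/-- The mixture likelihood of one market, `∑_m π_m ∏_t ∏_j Λ^q_j(θ^m, θ'^m, Y^m, P^m)(a_{jt}|x_t)`. -/
def mixLik (S : Model d dY J X A) (q : ℕ∞) (α : Params M d) (z : Aux M d dY J X A)
    (w : Path T J X A) : ℝ :=
  ∑ m, α.2 m * choiceProb (S.Λq q (α.1 m) (z.1 m) (z.2.1 m) (z.2.2 m)) w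

/-- The pseudo-likelihood `Q^q(θ, π; θ', Y, P)`. The averaging operator `avg` is the sample mean
over the markets, or the expectation. -/
def crit (S : Model d dY J X A) (q : ℕ∞) (avg : (Path T J X A → ℝ) → ℝ)
    (α : Params M d) (z : Aux M d dY J X A) : ℝ :=
  avg fun w => Real.log (mixLik S q α z w)

/-- `Θ^M × Δ^{M-1}`. -/
def paramSet (S : Model d dY J X A) (M : ℕ) : Set (Params M d) :=
  {α | (∀ m, α.1 m ∈ S.Θset) ∧ α.2 ∈ stdSimplex ℝ (Fin M)}

/-- `α` is a global maximizer of `Q^q(·; z)`. -/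
def IsArgmax (S : Model d dY J X A) (q : ℕ∞) (avg : (Path T J X A → ℝ) → ℝ)
    (z : Aux M d dY J X A) (α : Params M d) : Prop :=
  α ∈ paramSet S M ∧ IsMaxOn (fun a => crit S q avg a z) (paramSet S M) α

/-- The EM-NPL(q) fixed points (of the sample or of the population, according to `avg`). -/
def fixedPoints (S : Model d dY J X A) (q : ℕ∞) (avg : (Path T J X A → ℝ) → ℝ) :
    Set (State M d dY J X A) :=
  {s | IsArgmax S q avg s.2 (s.2.1, s.1) ∧
    ∀ m, s.2.2.1 m ∈ S.Yset ∧ s.2.2.2 m ∈ S.Pset ∧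
      s.2.2.1 m = S.Γ q (s.2.1 m) (s.2.1 m) (s.2.2.2 m) (s.2.2.1 m) ∧
      s.2.2.2 m = S.Λ (s.2.1 m) (s.2.2.1 m) (s.2.2.2 m)}

/-- The pseudo-likelihood of a fixed point, `Q^q(θ, π; θ, Y, P)`. -/
def critAt (S : Model d dY J X A) (q : ℕ∞) (avg : (Path T J X A → ℝ) → ℝ)
    (s : State M d dY J X A) : ℝ :=
  crit S q avg (s.2.1, s.1) s.2

/-- An EM-NPL(q) estimator: a fixed point that maximizes the pseudo-likelihood among them. -/
def IsEstimator (S : Model d dY J X A) (q : ℕ∞) (avg : (Path T J X A → ℝ) → ℝ)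
    (s : State M d dY J X A) : Prop :=
  s ∈ fixedPoints S q avg ∧ IsMaxOn (critAt S q avg) (fixedPoints S q avg) s

/-- Relabelling of the types. -/
def relabel (σ : Equiv.Perm (Fin M)) (s : State M d dY J X A) : State M d dY J X A :=
  (s.1 ∘ σ, s.2.1 ∘ σ, s.2.2.1 ∘ σ, s.2.2.2 ∘ σ)

/-- Relabelling of `(θ, π)`. -/
def relabelParams (σ : Equiv.Perm (Fin M)) (α : Params M d) : Params M d :=
  (α.1 ∘ σ, α.2 ∘ σ)

/-- The posterior type probability `w_m(P, π)` of a market with history `w`. -/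
def weight (P : Fin M → CCP J X A) (π : Fin M → ℝ) (m : Fin M) (w : Path T J X A) : ℝ :=
  π m * choiceProb (P m) w / ∑ m', π m' * choiceProb (P m') w

/-- `∑_t ∑_j log P_j(a_{jt}|x_t)`. -/
def logChoice (P : CCP J X A) (w : Path T J X A) : ℝ :=
  ∑ t, ∑ j, Real.log (P j (w t).1 ((w t).2 j))

/-- The E-step map `E(π, P) = 𝔼[w_1(P, π), …, w_M(P, π)]`. -/
def eStep (avg : (Path T J X A → ℝ) → ℝ) (π : Fin M → ℝ) (P : Fin M → CCP J X A) :
    Fin M → ℝ :=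
  fun m => avg (weight P π m)

/-- The M-step objective of type `m` at the candidate `ϑ`, given the previous state `s`. -/
def mObj (S : Model d dY J X A) (q : ℕ∞) (avg : (Path T J X A → ℝ) → ℝ)
    (s : State M d dY J X A) (m : Fin M) (ϑ : Fin d → ℝ) : ℝ :=
  avg fun w => weight s.2.2.2 s.1 m w *
    logChoice (S.Λq q ϑ (s.2.1 m) (s.2.2.1 m) (s.2.2.2 m)) w

/-- `s'` results from `s` by one iteration of the EM-NPL(q) algorithm: E-step, M-step (any global
maximizer over `Θ`), update of `Y` and of `P`. -/
def IsStep (S : Model d dY J X A) (q : ℕ∞) (avg : (Path T J X A → ℝ) → ℝ)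
    (s s' : State M d dY J X A) : Prop :=
  s'.1 = eStep avg s.1 s.2.2.2 ∧
  ∀ m, s'.2.1 m ∈ S.Θset ∧ IsMaxOn (mObj S q avg s m) S.Θset (s'.2.1 m) ∧
    s'.2.2.1 m = S.Γ q (s'.2.1 m) (s.2.1 m) (s.2.2.2 m) (s.2.2.1 m) ∧
    s'.2.2.2 m = S.Λ (s'.2.1 m) (s'.2.2.1 m) (s.2.2.2 m)

/-- `ℓ_E^q(θ; θ', Y, P, π) = ∑_m 𝔼[w_m(P, π) ∑_t ∑_j log Λ^q_j(θ^m, θ'^m, Y^m, P^m)(a_{jt}|x_t)]`. -/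
def ellE (S : Model d dY J X A) (q : ℕ∞) (avg : (Path T J X A → ℝ) → ℝ)
    (θ θ' : Fin M → Fin d → ℝ) (Y : Fin M → Fin dY → ℝ) (P : Fin M → CCP J X A)
    (π : Fin M → ℝ) : ℝ :=
  ∑ m, avg fun w => weight P π m w * logChoice (S.Λq q (θ m) (θ' m) (Y m) (P m)) w

/-- The gradient (as a linear functional) of `ℓ_E^q` in its first argument. -/
def scoreE (S : Model d dY J X A) (q : ℕ∞) (avg : (Path T J X A → ℝ) → ℝ)
    (θ θ' : Fin M → Fin d → ℝ) (Y : Fin M → Fin dY → ℝ) (P : Fin M → CCP J X A)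
    (π : Fin M → ℝ) : (Fin M → Fin d → ℝ) →L[ℝ] ℝ :=
  fderiv ℝ (fun ϑ => ellE S q avg ϑ θ' Y P π) θ

/-- The M-step Hessian `∇²_{θθ} ℓ_E^q` at the state `s`. -/
def hessE (S : Model d dY J X A) (q : ℕ∞) (avg : (Path T J X A → ℝ) → ℝ)
    (s : State M d dY J X A) :
    (Fin M → Fin d → ℝ) →L[ℝ] ((Fin M → Fin d → ℝ) →L[ℝ] ℝ) :=
  fderiv ℝ (fun ϑ => scoreE S q avg ϑ s.2.1 s.2.2.1 s.2.2.2 s.1) s.2.1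

/-! ### The blocks of the rate matrix, evaluated at a state `s` -/

/-- `E_π`. -/
def Eπ (avg : (Path T J X A → ℝ) → ℝ) (s : State M d dY J X A) :
    (Fin M → ℝ) →L[ℝ] (Fin M → ℝ) :=
  fderiv ℝ (fun π => eStep avg π s.2.2.2) s.1

/-- `E_P`. -/
def EP (avg : (Path T J X A → ℝ) → ℝ) (s : State M d dY J X A) :
    (Fin M → CCP J X A) →L[ℝ] (Fin M → ℝ) :=
  fderiv ℝ (fun P => eStep avg s.1 P) s.2.2.2

/-- `H_π^q = -(∇²_{θθ} ℓ_E^q)⁻¹ ∇²_{θπ} ℓ_E^q`. -/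
def Hπ (S : Model d dY J X A) (q : ℕ∞) (avg : (Path T J X A → ℝ) → ℝ)
    (s : State M d dY J X A) : (Fin M → ℝ) →L[ℝ] (Fin M → Fin d → ℝ) :=
  -(hessE S q avg s).inverse.comp
    (fderiv ℝ (fun π => scoreE S q avg s.2.1 s.2.1 s.2.2.1 s.2.2.2 π) s.1)

/-- `H_θ'^q = -(∇²_{θθ} ℓ_E^q)⁻¹ ∇²_{θθ'} ℓ_E^q`, where `θ'` is the previous iterate. -/
def Hθ' (S : Model d dY J X A) (q : ℕ∞) (avg : (Path T J X A → ℝ) → ℝ)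
    (s : State M d dY J X A) : (Fin M → Fin d → ℝ) →L[ℝ] (Fin M → Fin d → ℝ) :=
  -(hessE S q avg s).inverse.comp
    (fderiv ℝ (fun θ' => scoreE S q avg s.2.1 θ' s.2.2.1 s.2.2.2 s.1) s.2.1)

/-- `H_Y^q = -(∇²_{θθ} ℓ_E^q)⁻¹ ∇²_{θY} ℓ_E^q`. -/
def HY (S : Model d dY J X A) (q : ℕ∞) (avg : (Path T J X A → ℝ) → ℝ)
    (s : State M d dY J X A) : (Fin M → Fin dY → ℝ) →L[ℝ] (Fin M → Fin d → ℝ) :=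
  -(hessE S q avg s).inverse.comp
    (fderiv ℝ (fun Y => scoreE S q avg s.2.1 s.2.1 Y s.2.2.2 s.1) s.2.2.1)

/-- `H_P^q = -(∇²_{θθ} ℓ_E^q)⁻¹ ∇²_{θP} ℓ_E^q`. -/
def HP (S : Model d dY J X A) (q : ℕ∞) (avg : (Path T J X A → ℝ) → ℝ)
    (s : State M d dY J X A) : (Fin M → CCP J X A) →L[ℝ] (Fin M → Fin d → ℝ) :=
  -(hessE S q avg s).inverse.comp
    (fderiv ℝ (fun P => scoreE S q avg s.2.1 s.2.1 s.2.2.1 P s.1) s.2.2.2)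

/-- The block-diagonal operator with diagonal blocks `L m`. -/
def blockDiag {E F : Type*} [NormedAddCommGroup E] [NormedSpace ℝ E] [NormedAddCommGroup F]
    [NormedSpace ℝ F] (L : Fin M → E →L[ℝ] F) : (Fin M → E) →L[ℝ] (Fin M → F) :=
  ContinuousLinearMap.pi fun m => (L m).comp (ContinuousLinearMap.proj m)

/-- `Γ_θ^q`. -/
def Γθ (S : Model d dY J X A) (q : ℕ∞) (s : State M d dY J X A) :
    (Fin M → Fin d → ℝ) →L[ℝ] (Fin M → Fin dY → ℝ) :=
  blockDiag fun m => fderiv ℝ (fun θ => S.Γ q θ (s.2.1 m) (s.2.2.2 m) (s.2.2.1 m)) (s.2.1 m)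

/-- `Γ_θ'^q`. -/
def Γθ' (S : Model d dY J X A) (q : ℕ∞) (s : State M d dY J X A) :
    (Fin M → Fin d → ℝ) →L[ℝ] (Fin M → Fin dY → ℝ) :=
  blockDiag fun m => fderiv ℝ (fun θ' => S.Γ q (s.2.1 m) θ' (s.2.2.2 m) (s.2.2.1 m)) (s.2.1 m)

/-- `Γ_Y^q`. -/
def ΓY (S : Model d dY J X A) (q : ℕ∞) (s : State M d dY J X A) :
    (Fin M → Fin dY → ℝ) →L[ℝ] (Fin M → Fin dY → ℝ) :=
  blockDiag fun m => fderiv ℝ (fun Y => S.Γ q (s.2.1 m) (s.2.1 m) (s.2.2.2 m) Y) (s.2.2.1 m)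

/-- `Γ_P^q`. -/
def ΓP (S : Model d dY J X A) (q : ℕ∞) (s : State M d dY J X A) :
    (Fin M → CCP J X A) →L[ℝ] (Fin M → Fin dY → ℝ) :=
  blockDiag fun m => fderiv ℝ (fun P => S.Γ q (s.2.1 m) (s.2.1 m) P (s.2.2.1 m)) (s.2.2.2 m)

/-- `Λ^q_θ`. -/
def Λqθ (S : Model d dY J X A) (q : ℕ∞) (s : State M d dY J X A) :
    (Fin M → Fin d → ℝ) →L[ℝ] (Fin M → CCP J X A) :=
  blockDiag fun m => fderiv ℝ (fun θ => S.Λq q θ (s.2.1 m) (s.2.2.1 m) (s.2.2.2 m)) (s.2.1 m)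

/-- `Λ^q_θ'`. -/
def Λqθ' (S : Model d dY J X A) (q : ℕ∞) (s : State M d dY J X A) :
    (Fin M → Fin d → ℝ) →L[ℝ] (Fin M → CCP J X A) :=
  blockDiag fun m => fderiv ℝ (fun θ' => S.Λq q (s.2.1 m) θ' (s.2.2.1 m) (s.2.2.2 m)) (s.2.1 m)

/-- `Λ^q_Y`. -/
def ΛqY (S : Model d dY J X A) (q : ℕ∞) (s : State M d dY J X A) :
    (Fin M → Fin dY → ℝ) →L[ℝ] (Fin M → CCP J X A) :=
  blockDiag fun m => fderiv ℝ (fun Y => S.Λq q (s.2.1 m) (s.2.1 m) Y (s.2.2.2 m)) (s.2.2.1 m)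

/-- `Λ^q_P`. -/
def ΛqP (S : Model d dY J X A) (q : ℕ∞) (s : State M d dY J X A) :
    (Fin M → CCP J X A) →L[ℝ] (Fin M → CCP J X A) :=
  blockDiag fun m => fderiv ℝ (fun P => S.Λq q (s.2.1 m) (s.2.1 m) (s.2.2.1 m) P) (s.2.2.2 m)

/-- A block row `(a b c e)` acting on `(π, θ, Y, P)`. -/
def blockRow {F : Type*} [NormedAddCommGroup F] [NormedSpace ℝ F]
    (a : (Fin M → ℝ) →L[ℝ] F) (b : (Fin M → Fin d → ℝ) →L[ℝ] F)
    (c : (Fin M → Fin dY → ℝ) →L[ℝ] F) (e : (Fin M → CCP J X A) →L[ℝ] F) :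
    State M d dY J X A →L[ℝ] F :=
  a.coprod (b.coprod (c.coprod e))

/-- The rate matrix `R^q`, as a linear operator on states, with all blocks evaluated at `s`. -/
def rateMatrix (S : Model d dY J X A) (q : ℕ∞) (avg : (Path T J X A → ℝ) → ℝ)
    (s : State M d dY J X A) : State M d dY J X A →L[ℝ] State M d dY J X A :=
  (blockRow (Eπ avg s) 0 0 (EP avg s)).prod <|
  (blockRow (Hπ S q avg s) (Hθ' S q avg s) (HY S q avg s) (HP S q avg s)).prod <|
  (blockRow
    ((Γθ S q s).comp (Hπ S q avg s))
    ((Γθ S q s).comp (Hθ' S q avg s) + Γθ' S q s)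
    ((Γθ S q s).comp (HY S q avg s) + ΓY S q s)
    ((Γθ S q s).comp (HP S q avg s) + ΓP S q s)).prod <|
  (blockRow
    ((Λqθ S q s).comp (Hπ S q avg s))
    ((Λqθ S q s).comp (Hθ' S q avg s) + Λqθ' S q s)
    ((Λqθ S q s).comp (HY S q avg s) + ΛqY S q s)
    ((Λqθ S q s).comp (HP S q avg s) + ΛqP S q s))

/-! ### Assumptions -/

/-- For all `(θ, θ', P)`, the equation `Y = G(θ, θ', Y, P)` has a unique solution, `Γ^q(θ, θ', P; ·)`
is a self-map of the space of the nuisance parameter with the same fixed point, and the solution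
depends continuously on `(θ, θ', P)`. -/
structure SameFixedPoint (S : Model d dY J X A) (q : ℕ∞) : Prop where
  existsUnique : ∀ θ ∈ S.Θset, ∀ θ' ∈ S.Θset, ∀ P ∈ S.Pset, ∃! Y, Y ∈ S.Yset ∧ Y = S.G θ θ' Y P
  mapsTo : ∀ θ ∈ S.Θset, ∀ θ' ∈ S.Θset, ∀ P ∈ S.Pset, ∀ Y ∈ S.Yset, S.Γ q θ θ' P Y ∈ S.Yset
  same : ∀ θ ∈ S.Θset, ∀ θ' ∈ S.Θset, ∀ P ∈ S.Pset, ∀ Y ∈ S.Yset,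
    Y = S.Γ q θ θ' P Y ↔ Y = S.G θ θ' Y P
  continuous : ∀ Ysol : (Fin d → ℝ) × (Fin d → ℝ) × CCP J X A → (Fin dY → ℝ),
    (∀ θ ∈ S.Θset, ∀ θ' ∈ S.Θset, ∀ P ∈ S.Pset,
      Ysol (θ, θ', P) ∈ S.Yset ∧ Ysol (θ, θ', P) = S.G θ θ' (Ysol (θ, θ', P)) P) →
    ContinuousOn Ysol (S.Θset ×ˢ S.Θset ×ˢ S.Pset)

/-- Identification: `s` maximizes the pseudo-likelihood among all population fixed points, uniquely
up to label permutation, and it is an isolated population fixed point. -/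
structure Identified (S : Model d dY J X A) (q : ℕ∞) (avg : (Path T J X A → ℝ) → ℝ)
    (s : State M d dY J X A) : Prop where
  isEstimator : IsEstimator S q avg s
  unique : ∀ s', IsEstimator S q avg s' → ∃ σ, s' = relabel σ s
  isolated : ∃ r > 0, ∀ s' ∈ fixedPoints S q avg, ‖s' - s‖ < r → s' = s

/-- `φ_q(θ', Y, P) = (θ, Y', Λ(θ, Y', P))`, where `θ` is the `θ`-component of
`α(θ', Y, P)` and `Y' = Γ^q(θ, θ', P; Y)`. -/
def phi (S : Model d dY J X A) (q : ℕ∞) (α : Aux M d dY J X A → Params M d)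
    (z : Aux M d dY J X A) : Aux M d dY J X A :=
  ((α z).1,
    fun m => S.Γ q ((α z).1 m) (z.1 m) (z.2.2 m) (z.2.1 m),
    fun m => S.Λ ((α z).1 m) (S.Γ q ((α z).1 m) (z.1 m) (z.2.2 m) (z.2.1 m)) (z.2.2 m))

/-- Regularity conditions at the population fixed point `s`. -/
structure Regular (S : Model d dY J X A) (q : ℕ∞) (avg : (Path T J X A → ℝ) → ℝ)
    (s : State M d dY J X A) : Prop where
  Θ_compact : IsCompact S.Θset
  θ_interior : ∀ m, s.2.1 m ∈ interior S.Θset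
  π_pos : ∀ m, 0 < s.1 m
  Y_interior : ∀ m, s.2.2.1 m ∈ interior S.Yset
  P_compact : IsCompact S.Pset
  P_subset : S.Pset ⊆ ccpSet J X A
  P_interior : ∀ m, S.Pset ∈ 𝓝[ccpSet J X A] s.2.2.2 m
  G_smooth : ∀ θ ∈ S.Θset, ∀ θ' ∈ S.Θset, ∀ Y ∈ S.Yset, ∀ P ∈ S.Pset,
    ContDiffAt ℝ 2 (fun u : (Fin d → ℝ) × (Fin d → ℝ) × (Fin dY → ℝ) × CCP J X A =>
      S.G u.1 u.2.1 u.2.2.1 u.2.2.2) (θ, θ', Y, P)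
  Γ_smooth : ∀ θ ∈ S.Θset, ∀ θ' ∈ S.Θset, ∀ Y ∈ S.Yset, ∀ P ∈ S.Pset,
    ContDiffAt ℝ 3 (fun u : (Fin d → ℝ) × (Fin d → ℝ) × CCP J X A × (Fin dY → ℝ) =>
      S.Γ q u.1 u.2.1 u.2.2.1 u.2.2.2) (θ, θ', P, Y)
  Λ_smooth : ∀ θ ∈ S.Θset, ∀ Y ∈ S.Yset, ∀ P ∈ S.Pset,
    ContDiffAt ℝ 3 (fun u : (Fin d → ℝ) × (Fin dY → ℝ) × CCP J X A =>
      S.Λ u.1 u.2.1 u.2.2) (θ, Y, P)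
  /-- The Hessian of the population criterion in `(θ, π)` is negative definite; since `π` lives on
  the simplex, its increments sum to zero. -/
  hessian_neg : ∀ h : Params M d, h ≠ 0 → ∑ m, h.2 m = 0 →
    fderiv ℝ (fderiv ℝ fun α => crit S q avg α s.2) (s.2.1, s.1) h h < 0
  /-- For all `z` near `(θ*, Y*, P*)` the global maximizer of `Q^q(·; z)` is unique up to label
  permutations, i.e. up to permutations that are symmetries of the pseudo-likelihood there. -/
  argmax_unique : ∃ V ∈ 𝓝 s.2, ∀ z ∈ V, ∀ α α', IsArgmax S q avg z α → IsArgmax S q avg z α' →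
    ∃ σ, α' = relabelParams σ α ∧ ∀ z' ∈ V, ∀ β ∈ paramSet S M, ∀ w : Path T J X A,
      mixLik S q (relabelParams σ β) z' w = mixLik S q β z' w
  /-- `φ_q - id` has a nonsingular Jacobian at `(θ*, Y*, P*)`, where `α(·)` is the (locally unique)
  continuous choice of the global maximizer. -/
  phi_regular : ∃ α : Aux M d dY J X A → Params M d,
    (∀ᶠ z in 𝓝 s.2, IsArgmax S q avg z (α z)) ∧ α s.2 = (s.2.1, s.1) ∧ ContinuousAt α s.2 ∧
    ∃ D : Aux M d dY J X A →L[ℝ] Aux M d dY J X A, HasFDerivAt (phi S q α) D s.2 ∧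
      (D - ContinuousLinearMap.id ℝ _).IsInvertible
  /-- The matrix with rows `(I - Γ^q_Y, -Γ^q_P)`, `(-Λ_Y, I - Λ_P)` is invertible for each type. -/
  implicit_regular : ∀ m,
    ((ContinuousLinearMap.id ℝ ((Fin dY → ℝ) × CCP J X A)) -
      (((fderiv ℝ (fun Y => S.Γ q (s.2.1 m) (s.2.1 m) (s.2.2.2 m) Y) (s.2.2.1 m)).coprod
        (fderiv ℝ (fun P => S.Γ q (s.2.1 m) (s.2.1 m) P (s.2.2.1 m)) (s.2.2.2 m))).prod
      ((fderiv ℝ (fun Y => S.Λ (s.2.1 m) Y (s.2.2.2 m)) (s.2.2.1 m)).coprod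
        (fderiv ℝ (fun P => S.Λ (s.2.1 m) (s.2.2.1 m) P) (s.2.2.2 m))))).IsInvertible
  /-- The M-step Hessian is nonsingular. -/
  hessE_invertible : (hessE S q avg s).IsInvertible

end Maps

section Probability

variable {Ω : Type*} [MeasurableSpace Ω] {𝒲 : Type*}

/-- The mean over the first `N` observations, at the outcome `ω`. -/
def sampleAvg (W : ℕ → Ω → 𝒲) (N : ℕ) (ω : Ω) (g : 𝒲 → ℝ) : ℝ :=
  (1 / (N : ℝ)) * ∑ i ∈ Finset.range N, g (W i ω)

/-- The expectation under the law of one observation. -/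
def popAvg (μ : Measure Ω) (W : ℕ → Ω → 𝒲) (g : 𝒲 → ℝ) : ℝ :=
  ∫ ω, g (W 0 ω) ∂μ

/-- With probability approaching one (in outer probability). -/
def WPA1 (μ : Measure Ω) (p : ℕ → Ω → Prop) : Prop :=
  Tendsto (fun N => μ {ω | ¬ p N ω}) atTop (𝓝 0)

/-- `Z_N = O_p(b_N)`, for random `Z_N` and random `b_N ≥ 0`. -/
def IsBigOp (μ : Measure Ω) {E : Type*} [Norm E] (Z : ℕ → Ω → E) (b : ℕ → Ω → ℝ) : Prop :=
  ∀ ε : ENNReal, 0 < ε → ∃ C : ℝ, ∀ᶠ N in atTop, μ {ω | C * b N ω < ‖Z N ω‖} ≤ ε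

end Probability

end EMNPL

end

/-! A market history takes finitely many values, so the sample enters the criterion, the E-step and
the M-step only through the vector `p` of relative frequencies (`sampleAvg_eq_wavg`). Expectations
are the same functionals at the population probabilities `p₀` (`popAvg_eq_wavg`). The theorem is
therefore a deterministic statement about `(p, s)` near `(p₀, s₀)`, namely
`exists_uniform_expansion`, combined with Chebyshev's bound of order `N^{-1/2}` for `‖p - p₀‖`
(`exists_freq_bound`).

Near `(p₀, s₀)` every iteration, whichever maximizers the M-step picks, is given by one C² map Ψ
(`stepMap`), whose derivative in the state is the rate matrix R. The Jensen inequality of the EM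
algorithm (`em_minorization`) bounds gains of the M-step by gains of the criterion. Hence fixed
points with positive weights are stationary for the algorithm (`isStep_self`), and the population
M-step has a unique solution (`eq_of_isMaxOn_mObj`), which the implicit function theorem continues
to nearby `(p, s)`. An estimator `sh` being stationary, `s' - sh` equals Ψ(p, s) - Ψ(p, sh), and the
mean value inequality (`exists_expansion`) bounds its distance from R(s - sh) by a multiple of `(‖p
- p₀‖ + ‖sh - s₀‖ + ‖s - sh‖) * ‖s - sh‖`.

It remains to bound `‖sh - s₀‖` by a multiple of `‖p - p₀‖`. The definite Hessian gives a smooth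
local maximizer of the criterion, and nonsingularity of the Jacobian of φ_q - id then gives a smooth
path `ξ p` of fixed points, the only ones near `s₀` (`exists_fixedPoint_path`). Compactness and
comparison with `ξ p` force well-labelled estimators towards `s₀`
(`eventually_norm_estimator_sub_lt`), hence onto the path. Finally, consistency of the initial
values passes to each iterate by induction. -/

noncomputable section

namespace EMNPL

/-! ### Partial derivatives, implicit functions and a first-order expansion with parameters. -/

section Calculus

variable {E E₁ E₂ E₃ E₄ F : Type*}
  [NormedAddCommGroup E] [NormedSpace ℝ E]
  [NormedAddCommGroup E₁] [NormedSpace ℝ E₁] [NormedAddCommGroup E₂] [NormedSpace ℝ E₂]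
  [NormedAddCommGroup E₃] [NormedSpace ℝ E₃] [NormedAddCommGroup E₄] [NormedSpace ℝ E₄]
  [NormedAddCommGroup F] [NormedSpace ℝ F]

/-- A definite bilinear form on a finite-dimensional space is nondegenerate. -/
theorem isInvertible_of_apply_self_neg [FiniteDimensional ℝ E] (B : E →L[ℝ] (E →L[ℝ] ℝ))
    (hB : ∀ h ≠ 0, B h h < 0) : B.IsInvertible := by
  have hinj : Function.Injective B := by
    rw [injective_iff_map_eq_zero]
    intro h hh
    by_contra hne
    have := hB h hne
    simp [hh] at this
  have hdim : Module.finrank ℝ E = Module.finrank ℝ (E →L[ℝ] ℝ) := by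
    rw [← (LinearMap.toContinuousLinearMap (𝕜 := ℝ) (E := E) (F' := ℝ)).finrank_eq]
    exact (Subspace.dual_finrank_eq (K := ℝ) (V := E)).symm
  let e := LinearEquiv.ofInjectiveOfFinrankEq (B : E →ₗ[ℝ] (E →L[ℝ] ℝ)) hinj hdim
  exact ⟨e.toContinuousLinearEquiv, by ext; rfl⟩

theorem hasFDerivAt_fst_slice {f : E₁ × E₂ → F} {f' : E₁ × E₂ →L[ℝ] F} {x : E₁} {y : E₂}
    (hf : HasFDerivAt f f' (x, y)) :
    HasFDerivAt (fun x' => f (x', y)) (f'.comp (.inl ℝ E₁ E₂)) x :=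
  hf.comp x (hasFDerivAt_prodMk_left x y)

theorem hasFDerivAt_snd_slice {f : E₁ × E₂ → F} {f' : E₁ × E₂ →L[ℝ] F} {x : E₁} {y : E₂}
    (hf : HasFDerivAt f f' (x, y)) :
    HasFDerivAt (fun y' => f (x, y')) (f'.comp (.inr ℝ E₁ E₂)) y :=
  hf.comp y (hasFDerivAt_prodMk_right x y)

/-- The derivative of a function of two variables, in terms of the partial derivatives. -/
theorem fderiv_eq_coprod {f : E₁ × E₂ → F} {x : E₁} {y : E₂} (hf : DifferentiableAt ℝ f (x, y)) :
    fderiv ℝ f (x, y) =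
      (fderiv ℝ (fun x' => f (x', y)) x).coprod (fderiv ℝ (fun y' => f (x, y')) y) := by
  rw [(hasFDerivAt_fst_slice hf.hasFDerivAt).fderiv, (hasFDerivAt_snd_slice hf.hasFDerivAt).fderiv]
  ext v <;> simp

/-- The derivative of a function of four variables, in terms of the partial derivatives. -/
theorem fderiv_eq_coprod₄ {f : E₁ × E₂ × E₃ × E₄ → F} {x₁ : E₁} {x₂ : E₂} {x₃ : E₃} {x₄ : E₄}
    (hf : DifferentiableAt ℝ f (x₁, x₂, x₃, x₄)) :
    fderiv ℝ f (x₁, x₂, x₃, x₄) =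
      (fderiv ℝ (fun y => f (y, x₂, x₃, x₄)) x₁).coprod
        ((fderiv ℝ (fun y => f (x₁, y, x₃, x₄)) x₂).coprod
          ((fderiv ℝ (fun y => f (x₁, x₂, y, x₄)) x₃).coprod
            (fderiv ℝ (fun y => f (x₁, x₂, x₃, y)) x₄))) := by
  have h1 := (hasFDerivAt_snd_slice hf.hasFDerivAt).differentiableAt
  have h2 := (hasFDerivAt_snd_slice h1.hasFDerivAt).differentiableAt
  rw [fderiv_eq_coprod hf, fderiv_eq_coprod h1, fderiv_eq_coprod h2]

/-- The chain rule for a function of four variables, in terms of the partial derivatives. -/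
theorem hasFDerivAt_comp₄ {f : E₁ × E₂ × E₃ × E₄ → F} {g₁ : E → E₁} {g₂ : E → E₂} {g₃ : E → E₃}
    {g₄ : E → E₄} {g₁' : E →L[ℝ] E₁} {g₂' : E →L[ℝ] E₂} {g₃' : E →L[ℝ] E₃} {g₄' : E →L[ℝ] E₄}
    {e : E}
    (hf : DifferentiableAt ℝ f (g₁ e, g₂ e, g₃ e, g₄ e)) (h₁ : HasFDerivAt g₁ g₁' e)
    (h₂ : HasFDerivAt g₂ g₂' e) (h₃ : HasFDerivAt g₃ g₃' e) (h₄ : HasFDerivAt g₄ g₄' e) :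
    HasFDerivAt (fun x => f (g₁ x, g₂ x, g₃ x, g₄ x))
      ((fderiv ℝ (fun y => f (y, g₂ e, g₃ e, g₄ e)) (g₁ e)).comp g₁' +
        ((fderiv ℝ (fun y => f (g₁ e, y, g₃ e, g₄ e)) (g₂ e)).comp g₂' +
          ((fderiv ℝ (fun y => f (g₁ e, g₂ e, y, g₄ e)) (g₃ e)).comp g₃' +
            (fderiv ℝ (fun y => f (g₁ e, g₂ e, g₃ e, y)) (g₄ e)).comp g₄'))) e := by
  have := HasFDerivAt.comp (f := fun x => (g₁ x, g₂ x, g₃ x, g₄ x)) e hf.hasFDerivAt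
    (h₁.prodMk (h₂.prodMk (h₃.prodMk h₄)))
  rw [fderiv_eq_coprod₄ hf] at this
  exact this

/-- The implicit function theorem, with the derivative of the implicit function. -/
theorem exists_implicitFunction [CompleteSpace E₁] [CompleteSpace E₂] [CompleteSpace F]
    {f : E₁ × E₂ → F} {a : E₁} {b : E₂} {n : WithTop ℕ∞} (hf : ContDiffAt ℝ n f (a, b))
    (hn : n ≠ 0) (h0 : f (a, b) = 0) {L : E₂ →L[ℝ] F}
    (hL : HasFDerivAt (fun y => f (a, y)) L b) (hinv : L.IsInvertible) :
    ∃ ψ : E₁ → E₂, ContDiffAt ℝ n ψ a ∧ ψ a = b ∧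
      (∀ᶠ v in 𝓝 (a, b), f v = 0 ↔ ψ v.1 = v.2) ∧
      HasFDerivAt ψ (-(L.inverse.comp (fderiv ℝ (fun x => f (x, b)) a))) a := by
  have hd := (hf.differentiableAt hn).hasFDerivAt
  have hL' : fderiv ℝ f (a, b) ∘L .inr ℝ E₁ E₂ = L := (hasFDerivAt_snd_slice hd).unique hL
  have hinv' : (fderiv ℝ f (a, b) ∘L .inr ℝ E₁ E₂).IsInvertible := hL' ▸ hinv
  refine ⟨hf.implicitFunction hn hinv', hf.contDiffAt_implicitFunction hn hinv',
    hf.implicitFunction_apply_self hn hinv', ?_, ?_⟩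
  · simpa only [h0] using hf.eventually_apply_eq_iff_implicitFunction hn hinv'
  · have := (hf.hasStrictFDerivAt_implicitFunction hn hinv').hasFDerivAt
    rw [hL', ← (hasFDerivAt_fst_slice hd).fderiv] at this
    convert! this using 1

/-- First-order expansion of `Ψ(p, ·)` between two points near `s₀`, with a remainder that is
controlled by the distance of the parameter from `p₀`. -/
theorem exists_expansion {Ψ : E₁ × E₂ → F} {p₀ : E₁} {s₀ : E₂} (hΨ : ContDiffAt ℝ 2 Ψ (p₀, s₀))
    {R : E₂ →L[ℝ] F} (hR : HasFDerivAt (fun s => Ψ (p₀, s)) R s₀) :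
    ∃ K ≥ 0, ∃ ρ > 0, ∀ p s t, ‖p - p₀‖ < ρ → ‖s - s₀‖ < ρ → ‖t - s‖ < ρ →
      ‖Ψ (p, t) - Ψ (p, s) - R (t - s)‖ ≤ K * (‖p - p₀‖ + ‖s - s₀‖ + ‖t - s‖) * ‖t - s‖ := by
  have h1 : ContDiffAt ℝ 1 (fderiv ℝ Ψ) (p₀, s₀) := hΨ.fderiv_right (by norm_num)
  have hR' : (fderiv ℝ Ψ (p₀, s₀)).comp (.inr ℝ E₁ E₂) = R :=
    (hasFDerivAt_snd_slice (hΨ.differentiableAt (by norm_num)).hasFDerivAt).unique hR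
  -- A Lipschitz derivative is what produces the remainder: it stays within `K` times the distance
  -- to `(p₀, s₀)` of its value there, and that value restricts to `R`.
  obtain ⟨K, U, hU, hlip⟩ := h1.exists_lipschitzOnWith
  have hdiff : ∀ᶠ u in 𝓝 (p₀, s₀), DifferentiableAt ℝ Ψ u :=
    (hΨ.eventually (by simp)).mono fun u hu => hu.differentiableAt (by norm_num)
  obtain ⟨ρ, hρ, hball⟩ := Metric.mem_nhds_iff.1 (inter_mem hU hdiff)
  refine ⟨K, K.2, ρ / 2, by positivity, fun p s t hp hs ht => ?_⟩
  -- The closed ball of radius `δ` about `s₀` is convex and contains both `s` and `t`; halving `ρ`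
  -- keeps it inside the good neighbourhood.
  set δ := ‖s - s₀‖ + ‖t - s‖
  have hin : ∀ x ∈ Metric.closedBall s₀ δ, (p, x) ∈ Metric.ball (p₀, s₀) ρ := by
    intro x hx
    rw [mem_closedBall_iff_norm] at hx
    rw [mem_ball_iff_norm, Prod.norm_def]
    exact max_lt (by simpa using hp.trans (by linarith)) (by simp only [Prod.snd_sub]; linarith)
  refine (convex_closedBall s₀ δ).norm_image_sub_le_of_norm_hasFDerivWithin_le'
    (f := fun x => Ψ (p, x)) (f' := fun x => (fderiv ℝ Ψ (p, x)).comp (.inr ℝ E₁ E₂))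
    (fun x hx => ?_) (fun x hx => ?_) ?_ ?_
  · exact (hasFDerivAt_snd_slice (hball (hin x hx)).2.hasFDerivAt).hasFDerivWithinAt
  · rw [← hR', ← ContinuousLinearMap.sub_comp]
    have hl := hlip.dist_le_mul _ (hball (hin x hx)).1 _ (mem_of_mem_nhds hU)
    rw [dist_eq_norm, dist_eq_norm] at hl
    rw [mem_closedBall_iff_norm] at hx
    calc _ ≤ ‖fderiv ℝ Ψ (p, x) - fderiv ℝ Ψ (p₀, s₀)‖ * ‖ContinuousLinearMap.inr ℝ E₁ E₂‖ :=
          ContinuousLinearMap.opNorm_comp_le _ _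
      _ ≤ ‖fderiv ℝ Ψ (p, x) - fderiv ℝ Ψ (p₀, s₀)‖ * 1 := by
          gcongr; exact ContinuousLinearMap.norm_inr_le_one ℝ E₁ E₂
      _ ≤ _ := by
          rw [mul_one]
          refine hl.trans ?_
          gcongr
          rw [Prod.norm_def, add_assoc]
          exact max_le
            (by simp only [Prod.fst_sub]; linarith [norm_nonneg (s - s₀), norm_nonneg (t - s)])
            (by simp only [Prod.snd_sub]; linarith [norm_nonneg (p - p₀)])
  · rw [mem_closedBall_iff_norm]; linarith [norm_nonneg (t - s)]
  · rw [mem_closedBall_iff_norm]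
    calc _ = ‖(t - s) + (s - s₀)‖ := by congr 1; abel
      _ ≤ _ := (norm_add_le _ _).trans (by linarith)

end Calculus

/-! ### Stability of maximizers over a compact set. -/

section Argmax

variable {U E : Type*} [TopologicalSpace U] [TopologicalSpace E]

/-- Upper hemicontinuity of the set of maximizers over a compact set. -/
theorem eventually_isMaxOn_mem {g : U → E → ℝ} {K O : Set E} {u₀ : U} (hK : IsCompact K)
    (hg : ∀ x ∈ K, ContinuousAt (fun v : U × E => g v.1 v.2) (u₀, x)) (hO : IsOpen O)
    (hmax : ∀ x ∈ K, IsMaxOn (g u₀) K x → x ∈ O) :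
    ∀ᶠ u in 𝓝 u₀, ∀ x ∈ K, IsMaxOn (g u) K x → x ∈ O := by
  have key := (hK.diff hO).eventually_forall_of_forall_eventually (x₀ := u₀)
    (P := fun u x => x ∈ K → IsMaxOn (g u) K x → x ∈ O) fun x hx => ?_
  · filter_upwards [key] with u hu x hxK hxm
    by_cases hxO : x ∈ O
    · exact hxO
    · exact hu x ⟨hxK, hxO⟩ hxK hxm
  -- A point outside `O` is strictly beaten by some `y` at `u₀`. The strict inequality persists near
  -- `(u₀, x)`, and compactness of `K \ O` makes this uniform in `x`.
  · have : ¬ IsMaxOn (g u₀) K x := fun h => hx.2 (hmax x hx.1 h)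
    simp only [IsMaxOn, IsMaxFilter, eventually_principal, not_forall, not_le] at this
    obtain ⟨y, hy, hlt⟩ := this
    have hc : ContinuousAt (fun v : U × E => g v.1 y) (u₀, x) :=
      ContinuousAt.comp (g := fun v : U × E => g v.1 v.2) (f := fun v : U × E => (v.1, y)) (hg y hy)
        (continuousAt_fst.prodMk continuousAt_const)
    filter_upwards [(hg x hx.1).eventually_lt hc hlt] with v hv _ hm
    exact absurd (hm hy) (not_le.2 hv)

end Argmax

/-! ### Jensen's and Gibbs' inequalities for the logarithm. -/

section Inequalities

variable {ι : Type*} [Fintype ι]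

/-- The inequality behind the EM algorithm. -/
theorem sum_div_mul_log_sub_log_le [Nonempty ι] {a b : ι → ℝ}
    (ha : ∀ i, 0 < a i) (hb : ∀ i, 0 < b i) :
    ∑ i, a i / (∑ j, a j) * (Real.log (b i) - Real.log (a i)) ≤
      Real.log (∑ i, b i) - Real.log (∑ i, a i) := by
  have hA : 0 < ∑ j, a j := Finset.sum_pos (fun i _ => ha i) Finset.univ_nonempty
  have hB : 0 < ∑ j, b j := Finset.sum_pos (fun i _ => hb i) Finset.univ_nonempty
  -- Jensen's inequality at the points `b i / a i` with weights `a i / ∑ j, a j`.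
  have := strictConcaveOn_log_Ioi.concaveOn.le_map_sum (t := Finset.univ)
    (w := fun i => a i / ∑ j, a j) (p := fun i => b i / a i) (fun i _ => (div_pos (ha i) hA).le)
    (by rw [← Finset.sum_div, div_self hA.ne']) (fun i _ => div_pos (hb i) (ha i))
  simp only [smul_eq_mul] at this
  rw [← Real.log_div hB.ne' hA.ne']
  have h1 : ∀ i, Real.log (b i) - Real.log (a i) = Real.log (b i / a i) := fun i =>
    (Real.log_div (hb i).ne' (ha i).ne').symm
  have h2 : ∑ i, a i / (∑ j, a j) * (b i / a i) = (∑ j, b j) / ∑ j, a j := by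
    rw [Finset.sum_div]
    refine Finset.sum_congr rfl fun i _ => ?_
    have := (ha i).ne'
    field_simp
  simpa only [h1, h2] using this

/-- Gibbs' inequality, equality case. -/
theorem eq_of_sum_mul_log_sub_log_nonpos {a b : ι → ℝ} (ha : ∀ i, 0 < a i) (hb : ∀ i, 0 < b i)
    (hsum : ∑ i, a i = ∑ i, b i) (h : ∑ i, b i * (Real.log (b i) - Real.log (a i)) ≤ 0) :
    b = a := by
  -- Subtracting `b i - a i`, which sums to zero, makes every summand nonnegative because log x ≤ x
  -- - 1 at x = `a i / b i`. All summands then vanish, and strictness away from x = 1 gives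
  -- equality.
  have hterm : ∀ i, 0 ≤ b i * (Real.log (b i) - Real.log (a i)) - (b i - a i) := by
    intro i
    have h1 := Real.log_le_sub_one_of_pos (div_pos (ha i) (hb i))
    rw [Real.log_div (ha i).ne' (hb i).ne'] at h1
    have h2 := mul_le_mul_of_nonneg_left h1 (hb i).le
    have h3 : b i * (a i / b i - 1) = a i - b i := by have := (hb i).ne'; field_simp
    linarith
  have hz : ∑ i, (b i * (Real.log (b i) - Real.log (a i)) - (b i - a i)) = 0 := by
    refine le_antisymm ?_ (Finset.sum_nonneg fun i _ => hterm i)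
    rw [Finset.sum_sub_distrib, Finset.sum_sub_distrib, hsum]
    linarith
  funext i
  have hi := (Finset.sum_eq_zero_iff_of_nonneg fun i _ => hterm i).1 hz i (Finset.mem_univ i)
  by_contra hne
  have h1 := Real.log_lt_sub_one_of_pos (div_pos (ha i) (hb i))
    (fun h => hne ((div_eq_one_iff_eq (hb i).ne').1 h).symm)
  rw [Real.log_div (ha i).ne' (hb i).ne'] at h1
  have h2 := mul_lt_mul_of_pos_left h1 (hb i)
  have h3 : b i * (a i / b i - 1) = a i - b i := by have := (hb i).ne'; field_simp
  linarith

end Inequalities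

/-- The averaging operator with weights `p`. -/
def wavg {𝒲 : Type*} [Fintype 𝒲] (p : 𝒲 → ℝ) (g : 𝒲 → ℝ) : ℝ :=
  ∑ w, p w * g w

/-- The weights vary together with the integrand, so that sampling error can be treated as one more
smooth parameter. -/
theorem wavg_contDiffAt {E : Type*} [NormedAddCommGroup E] [NormedSpace ℝ E] {𝒲 : Type*} [Fintype 𝒲]
    {n : WithTop ℕ∞} {p : E → 𝒲 → ℝ}
    {g : E → 𝒲 → ℝ} {e : E} (hp : ContDiffAt ℝ n p e)
    (hg : ∀ w, ContDiffAt ℝ n (fun x => g x w) e) :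
    ContDiffAt ℝ n (fun x => wavg (p x) (g x)) e :=
  ContDiffAt.sum fun w _ => (contDiffAt_pi.1 hp w).mul (hg w)

/-! ### Positivity of logit choice probabilities. -/

section Maps

variable {J T : ℕ} {X A : Type*}

theorem choiceProb_pos {P : CCP J X A} (hP : ∀ j x a, 0 < P j x a) (w : Path T J X A) :
    0 < choiceProb P w :=
  Finset.prod_pos fun _ _ => Finset.prod_pos fun _ _ => hP _ _ _

theorem log_choiceProb {P : CCP J X A} (hP : ∀ j x a, 0 < P j x a) (w : Path T J X A) :
    Real.log (choiceProb P w) = logChoice P w := by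
  unfold choiceProb logChoice
  rw [Real.log_prod fun t _ => (Finset.prod_pos fun _ _ => hP _ _ _).ne']
  exact Finset.sum_congr rfl fun t _ => Real.log_prod fun j _ => (hP _ _ _).ne'

variable {d dY : ℕ} [Fintype A]

theorem Model.Λ_pos (S : Model d dY J X A) (θ : Fin d → ℝ) (Y : Fin dY → ℝ) (P : CCP J X A)
    (j : Fin J) (x : X) (a : A) : 0 < S.Λ θ Y P j x a :=
  div_pos (Real.exp_pos _) (Finset.sum_pos (fun _ _ => Real.exp_pos _) ⟨a, Finset.mem_univ a⟩)

theorem Model.Λ_mem_ccpSet (hA : ∀ (_ : Fin J) (_ : X), Nonempty A) (S : Model d dY J X A)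
    (θ : Fin d → ℝ) (Y : Fin dY → ℝ) (P : CCP J X A) : S.Λ θ Y P ∈ ccpSet J X A := by
  intro j x
  have : Nonempty A := hA j x
  refine ⟨fun a => (S.Λ_pos θ Y P j x a).le, ?_⟩
  simp only [Model.Λ]
  rw [← Finset.sum_div]
  exact div_self (Finset.sum_pos (fun _ _ => Real.exp_pos _) Finset.univ_nonempty).ne'

theorem Model.choiceProb_Λq_pos (S : Model d dY J X A) (q : ℕ∞) (θ θ' : Fin d → ℝ)
    (Y : Fin dY → ℝ) (P : CCP J X A) (w : Path T J X A) : 0 < choiceProb (S.Λq q θ θ' Y P) w :=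
  choiceProb_pos (fun _ _ _ => S.Λ_pos _ _ _ _ _ _) w

end Maps

/-! ### Smoothness of the criterion and of the E- and M-step objectives. -/

section Maps

variable {M d dY J T : ℕ} {X A : Type*} [Fintype X] [Fintype A]
  {E : Type*} [NormedAddCommGroup E] [NormedSpace ℝ E]

/-- The domain of the auxiliary arguments `z = (θ, Y, P)`. -/
def auxSet (S : Model d dY J X A) (M : ℕ) : Set (Aux M d dY J X A) :=
  {z | ∀ m, z.1 m ∈ S.Θset ∧ z.2.1 m ∈ S.Yset ∧ z.2.2 m ∈ S.Pset}

omit [Fintype X] in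
-- Some mixing weight is positive because they sum to one. The closed simplex is allowed, so the
-- log-likelihood is smooth on all of the compact parameter set.
theorem mixLik_pos (S : Model d dY J X A) (q : ℕ∞) {α : Params M d}
    (hα : α.2 ∈ stdSimplex ℝ (Fin M)) (z : Aux M d dY J X A) (w : Path T J X A) :
    0 < mixLik S q α z w := by
  obtain ⟨m, hm⟩ : ∃ m, 0 < α.2 m := by
    by_contra! h
    have := Finset.sum_nonpos fun m (_ : m ∈ Finset.univ) => h m
    rw [hα.2] at this
    norm_num at this
  exact Finset.sum_pos' (fun m _ => mul_nonneg (hα.1 m) (S.choiceProb_Λq_pos q _ _ _ _ w).le)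
    ⟨m, Finset.mem_univ m, mul_pos hm (S.choiceProb_Λq_pos q _ _ _ _ w)⟩

theorem choiceProb_contDiffAt {n : WithTop ℕ∞} {P : E → CCP J X A} {e : E}
    (hP : ContDiffAt ℝ n P e) (w : Path T J X A) :
    ContDiffAt ℝ n (fun x => choiceProb (P x) w) e := by
  simp only [contDiffAt_pi] at hP
  exact contDiffAt_prod fun t _ => contDiffAt_prod fun j _ => hP _ _ _

theorem logChoice_contDiffAt {n : WithTop ℕ∞} {P : E → CCP J X A} {e : E}
    (hP : ContDiffAt ℝ n P e) (hpos : ∀ j x a, 0 < P e j x a) (w : Path T J X A) :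
    ContDiffAt ℝ n (fun x => logChoice (P x) w) e := by
  simp only [contDiffAt_pi] at hP
  exact ContDiffAt.sum fun t _ => ContDiffAt.sum fun j _ => (hP _ _ _).log (hpos _ _ _).ne'

theorem weight_contDiffAt {n : WithTop ℕ∞} {P : E → Fin M → CCP J X A} {π : E → Fin M → ℝ} {e : E}
    (hP : ContDiffAt ℝ n P e) (hπ : ContDiffAt ℝ n π e) (hpos : ∀ m j x a, 0 < P e m j x a)
    (hπpos : ∀ m, 0 < π e m) (m : Fin M) (w : Path T J X A) :
    ContDiffAt ℝ n (fun x => weight (P x) (π x) m w) e := by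
  have h : ∀ m, ContDiffAt ℝ n (fun x => π x m * choiceProb (P x m) w) e := fun m =>
    (contDiffAt_pi.1 hπ m).mul (choiceProb_contDiffAt (contDiffAt_pi.1 hP m) w)
  exact (h m).div (ContDiffAt.sum fun m' _ => h m')
    (Finset.sum_pos (fun m' _ => mul_pos (hπpos m') (choiceProb_pos (hpos m') w))
      ⟨m, Finset.mem_univ m⟩).ne'

theorem eStep_contDiffAt {n : WithTop ℕ∞} {P : E → Fin M → CCP J X A} {π : E → Fin M → ℝ}
    {p : E → Path T J X A → ℝ} {e : E} (hp : ContDiffAt ℝ n p e)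
    (hP : ContDiffAt ℝ n P e) (hπ : ContDiffAt ℝ n π e) (hpos : ∀ m j x a, 0 < P e m j x a)
    (hπpos : ∀ m, 0 < π e m) : ContDiffAt ℝ n (fun x => eStep (wavg (p x)) (π x) (P x)) e :=
  contDiffAt_pi.2 fun m => wavg_contDiffAt hp fun w => weight_contDiffAt hP hπ hpos hπpos m w

section Regular

variable {S : Model d dY J X A} {q : ℕ∞} {avg : (Path T J X A → ℝ) → ℝ}
  {s : State M d dY J X A} (hfix : SameFixedPoint S q) (hreg : Regular S q avg s)

include hreg in
theorem Γ_contDiffAt {θ θ' : E → Fin d → ℝ} {Y : E → Fin dY → ℝ} {P : E → CCP J X A} {e : E}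
    {n : WithTop ℕ∞} (hn : n ≤ 3)
    (h1 : ContDiffAt ℝ n θ e) (h2 : ContDiffAt ℝ n θ' e) (h3 : ContDiffAt ℝ n Y e)
    (h4 : ContDiffAt ℝ n P e) (m1 : θ e ∈ S.Θset) (m2 : θ' e ∈ S.Θset) (m3 : Y e ∈ S.Yset)
    (m4 : P e ∈ S.Pset) : ContDiffAt ℝ n (fun x => S.Γ q (θ x) (θ' x) (P x) (Y x)) e :=
  ContDiffAt.comp (g := fun u : (Fin d → ℝ) × (Fin d → ℝ) × CCP J X A × (Fin dY → ℝ) =>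
    S.Γ q u.1 u.2.1 u.2.2.1 u.2.2.2) (f := fun x => (θ x, θ' x, P x, Y x)) e
    ((hreg.Γ_smooth _ m1 _ m2 _ m3 _ m4).of_le hn) (h1.prodMk (h2.prodMk (h4.prodMk h3)))

include hfix hreg in
-- The inner algorithm maps `S.Yset` into itself, so smoothness of Λ is available at the updated
-- nuisance parameter.
theorem Λq_contDiffAt {θ θ' : E → Fin d → ℝ} {Y : E → Fin dY → ℝ} {P : E → CCP J X A} {e : E}
    {n : WithTop ℕ∞} (hn : n ≤ 3)
    (h1 : ContDiffAt ℝ n θ e) (h2 : ContDiffAt ℝ n θ' e) (h3 : ContDiffAt ℝ n Y e)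
    (h4 : ContDiffAt ℝ n P e) (m1 : θ e ∈ S.Θset) (m2 : θ' e ∈ S.Θset) (m3 : Y e ∈ S.Yset)
    (m4 : P e ∈ S.Pset) : ContDiffAt ℝ n (fun x => S.Λq q (θ x) (θ' x) (Y x) (P x)) e :=
  ContDiffAt.comp (g := fun u : (Fin d → ℝ) × (Fin dY → ℝ) × CCP J X A => S.Λ u.1 u.2.1 u.2.2)
    (f := fun x => (θ x, S.Γ q (θ x) (θ' x) (P x) (Y x), P x)) e
    ((hreg.Λ_smooth _ m1 _ (hfix.mapsTo _ m1 _ m2 _ m4 _ m3) _ m4).of_le hn)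
    (h1.prodMk ((Γ_contDiffAt hreg hn h1 h2 h3 h4 m1 m2 m3 m4).prodMk h4))

include hfix hreg in
theorem mixLik_contDiffAt {α : E → Params M d} {z : E → Aux M d dY J X A} {e : E}
    (hα : ContDiffAt ℝ 3 α e) (hz : ContDiffAt ℝ 3 z e) (hαm : ∀ m, (α e).1 m ∈ S.Θset)
    (hzm : z e ∈ auxSet S M) (w : Path T J X A) :
    ContDiffAt ℝ 3 (fun x => mixLik S q (α x) (z x) w) e := by
  refine ContDiffAt.sum fun m _ => (contDiffAt_pi.1 hα.snd m).mul (choiceProb_contDiffAt ?_ w)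
  exact Λq_contDiffAt hfix hreg le_rfl (contDiffAt_pi.1 hα.fst m) (contDiffAt_pi.1 hz.fst m)
    (contDiffAt_pi.1 hz.snd.fst m) (contDiffAt_pi.1 hz.snd.snd m) (hαm m) (hzm m).1 (hzm m).2.1
    (hzm m).2.2

include hfix hreg in
theorem crit_contDiffAt {p : E → Path T J X A → ℝ} {α : E → Params M d}
    {z : E → Aux M d dY J X A} {e : E} (hp : ContDiffAt ℝ 3 p e)
    (hα : ContDiffAt ℝ 3 α e) (hz : ContDiffAt ℝ 3 z e) (hαm : α e ∈ paramSet S M)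
    (hzm : z e ∈ auxSet S M) : ContDiffAt ℝ 3 (fun x => crit S q (wavg (p x)) (α x) (z x)) e :=
  wavg_contDiffAt hp fun w => (mixLik_contDiffAt hfix hreg hα hz hαm.1 hzm w).log
    (mixLik_pos S q hαm.2 _ w).ne'

include hfix hreg in
-- The posterior weights use `P` itself rather than a logit image, so positivity of `P` and of the
-- mixing weights must be assumed. Three derivatives are kept because passing to the score costs one
-- and the expansion needs two.
theorem mObj_contDiffAt {p : E → Path T J X A → ℝ} {u : E → State M d dY J X A}
    {ϑ : E → Fin d → ℝ} {e : E} (hp : ContDiffAt ℝ 3 p e) (hu : ContDiffAt ℝ 3 u e)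
    (hϑ : ContDiffAt ℝ 3 ϑ e) (hum : (u e).2 ∈ auxSet S M)
    (hpos : ∀ m j x a, 0 < (u e).2.2.2 m j x a) (hπpos : ∀ m, 0 < (u e).1 m)
    (hϑm : ϑ e ∈ S.Θset) (m : Fin M) :
    ContDiffAt ℝ 3 (fun x => mObj S q (wavg (p x)) (u x) m (ϑ x)) e := by
  refine wavg_contDiffAt hp fun w =>
    (weight_contDiffAt hu.snd.snd.snd hu.fst hpos hπpos m w).mul (logChoice_contDiffAt ?_ ?_ w)
  · exact Λq_contDiffAt hfix hreg le_rfl hϑ (contDiffAt_pi.1 hu.snd.fst m)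
      (contDiffAt_pi.1 hu.snd.snd.fst m) (contDiffAt_pi.1 hu.snd.snd.snd m) hϑm (hum m).1
      (hum m).2.1 (hum m).2.2
  · exact fun _ _ _ => S.Λ_pos _ _ _ _ _ _

include hfix hreg in
theorem ellE_contDiffAt {p : E → Path T J X A → ℝ} {u : E → State M d dY J X A}
    {ϑ : E → Fin M → Fin d → ℝ} {e : E} (hp : ContDiffAt ℝ 3 p e) (hu : ContDiffAt ℝ 3 u e)
    (hϑ : ContDiffAt ℝ 3 ϑ e) (hum : (u e).2 ∈ auxSet S M)
    (hpos : ∀ m j x a, 0 < (u e).2.2.2 m j x a) (hπpos : ∀ m, 0 < (u e).1 m)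
    (hϑm : ∀ m, ϑ e m ∈ S.Θset) :
    ContDiffAt ℝ 3 (fun x => ellE S q (wavg (p x)) (ϑ x) (u x).2.1 (u x).2.2.1 (u x).2.2.2
      (u x).1) e :=
  ContDiffAt.sum fun m _ =>
    mObj_contDiffAt hfix hreg hp hu (contDiffAt_pi.1 hϑ m) hum hpos hπpos (hϑm m) m

end Regular

end Maps

/-! ### Fixed points of the criterion as stationary points of the EM algorithm. -/

section EM

variable {M d dY J T : ℕ} {X A : Type*} [Fintype X] [Fintype A] {S : Model d dY J X A} {q : ℕ∞}
  {p : Path T J X A → ℝ} {s : State M d dY J X A}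

omit [Fintype X] in
-- The inner algorithm leaves `Y` unchanged, and Λ then returns `P`. This makes the E-step
-- posterior, computed from `P`, the posterior of the mixture likelihood in the criterion.
theorem Λq_eq_of_mem_fixedPoints {avg : (Path T J X A → ℝ) → ℝ} (hs : s ∈ fixedPoints S q avg)
    (m : Fin M) : S.Λq q (s.2.1 m) (s.2.1 m) (s.2.2.1 m) (s.2.2.2 m) = s.2.2.2 m := by
  obtain ⟨-, -, hY, hP⟩ := hs.2 m
  rw [Model.Λq, ← hY, ← hP]

omit [Fintype X] in
theorem pos_of_mem_fixedPoints {avg : (Path T J X A → ℝ) → ℝ} (hs : s ∈ fixedPoints S q avg)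
    (m : Fin M) (j : Fin J) (x : X) (a : A) : 0 < s.2.2.2 m j x a := by
  rw [← Λq_eq_of_mem_fixedPoints hs m]
  exact S.Λ_pos _ _ _ _ _ _

omit [Fintype X] in
theorem nonempty_of_mem_fixedPoints {avg : (Path T J X A → ℝ) → ℝ}
    (hs : s ∈ fixedPoints S q avg) : Nonempty (Fin M) := by
  by_contra h
  rw [not_nonempty_iff] at h
  have := hs.1.1.2.2
  simp at this

/-- The minorization property of the EM algorithm at a fixed point. -/
theorem em_minorization (hp : ∀ w, 0 ≤ p w) (hs : s ∈ fixedPoints S q (wavg p))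
    (hπ : ∀ m, 0 < s.1 m) (β : Params M d) (hβ : ∀ m, 0 < β.2 m) :
    ∑ m, eStep (wavg p) s.1 s.2.2.2 m * (Real.log (β.2 m) - Real.log (s.1 m)) +
      ∑ m, (mObj S q (wavg p) s m (β.1 m) - mObj S q (wavg p) s m (s.2.1 m)) ≤
      crit S q (wavg p) β s.2 - crit S q (wavg p) (s.2.1, s.1) s.2 := by
  have : Nonempty (Fin M) := nonempty_of_mem_fixedPoints hs
  have hPpos := pos_of_mem_fixedPoints hs
  set B := fun m => S.Λq q (β.1 m) (s.2.1 m) (s.2.2.1 m) (s.2.2.2 m)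
  have hB : ∀ m j x a, 0 < B m j x a := fun m _ _ _ => S.Λ_pos _ _ _ _ _ _
  have hw : ∀ w : Path T J X A, ∑ m, weight s.2.2.2 s.1 m w *
      ((Real.log (β.2 m) - Real.log (s.1 m)) +
        (logChoice (B m) w - logChoice (s.2.2.2 m) w)) ≤
      Real.log (mixLik S q β s.2 w) - Real.log (mixLik S q (s.2.1, s.1) s.2 w) := by
    intro w
    -- With these type-specific likelihoods the Jensen weights are exactly the posterior
    -- probabilities of the E-step.
    have := sum_div_mul_log_sub_log_le (a := fun m => s.1 m * choiceProb (s.2.2.2 m) w)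
      (b := fun m => β.2 m * choiceProb (B m) w)
      (fun m => mul_pos (hπ m) (choiceProb_pos (hPpos m) w))
      (fun m => mul_pos (hβ m) (choiceProb_pos (hB m) w))
    convert this using 1
    · refine Finset.sum_congr rfl fun m _ => ?_
      simp only [weight]
      congr 1
      rw [Real.log_mul (hβ m).ne' (choiceProb_pos (hB m) w).ne',
        Real.log_mul (hπ m).ne' (choiceProb_pos (hPpos m) w).ne',
        log_choiceProb (hB m), log_choiceProb (hPpos m)]
      ring
    · simp only [mixLik, Λq_eq_of_mem_fixedPoints hs]
      rfl
  have hsum := Finset.sum_le_sum fun w (_ : w ∈ Finset.univ) =>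
    mul_le_mul_of_nonneg_left (hw w) (hp w)
  have hR : crit S q (wavg p) β s.2 - crit S q (wavg p) (s.2.1, s.1) s.2 = ∑ w, p w *
      (Real.log (mixLik S q β s.2 w) - Real.log (mixLik S q (s.2.1, s.1) s.2 w)) := by
    simp only [crit, wavg, mul_sub, Finset.sum_sub_distrib]
  rw [hR]
  refine le_trans (le_of_eq ?_) hsum
  simp only [eStep, mObj, wavg, Λq_eq_of_mem_fixedPoints hs, Finset.mul_sum, Finset.sum_mul,
    ← Finset.sum_sub_distrib, ← Finset.sum_add_distrib]
  rw [Finset.sum_comm]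
  refine Finset.sum_congr rfl fun w _ => Finset.sum_congr rfl fun m _ => ?_
  ring

omit [Fintype X] [Fintype A] in
theorem sum_weight {P : Fin M → CCP J X A} {π : Fin M → ℝ} [Nonempty (Fin M)]
    (hP : ∀ m j x a, 0 < P m j x a) (hπ : ∀ m, 0 < π m) (w : Path T J X A) :
    ∑ m, weight P π m w = 1 := by
  simp only [weight]
  rw [← Finset.sum_div]
  exact div_self (Finset.sum_pos (fun m _ => mul_pos (hπ m) (choiceProb_pos (hP m) w))
    Finset.univ_nonempty).ne'

/-- The mixing weights of a fixed point are reproduced by the E-step. -/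
theorem eStep_eq_of_mem_fixedPoints (hp : ∀ w, 0 ≤ p w) (hp1 : ∑ w, p w = 1)
    (hs : s ∈ fixedPoints S q (wavg p)) (hπ : ∀ m, 0 < s.1 m) :
    eStep (wavg p) s.1 s.2.2.2 = s.1 := by
  have : Nonempty (Fin M) := nonempty_of_mem_fixedPoints hs
  have hPpos := pos_of_mem_fixedPoints hs
  have hwpos : ∀ m (w : Path T J X A), 0 < weight s.2.2.2 s.1 m w := fun m w =>
    div_pos (mul_pos (hπ m) (choiceProb_pos (hPpos m) w))
      (Finset.sum_pos (fun m _ => mul_pos (hπ m) (choiceProb_pos (hPpos m) w))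
        Finset.univ_nonempty)
  have hpos : ∀ m, 0 < eStep (wavg p) s.1 s.2.2.2 m := by
    intro m
    obtain ⟨w, hw⟩ : ∃ w, 0 < p w := by
      by_contra! h
      have := Finset.sum_nonpos fun w (_ : w ∈ Finset.univ) => h w
      rw [hp1] at this
      norm_num at this
    exact Finset.sum_pos' (fun w _ => mul_nonneg (hp w) (hwpos m w).le)
      ⟨w, Finset.mem_univ w, mul_pos hw (hwpos m w)⟩
  have hsum : ∑ m, eStep (wavg p) s.1 s.2.2.2 m = 1 := by
    simp only [eStep, wavg]
    rw [Finset.sum_comm]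
    simp only [← Finset.mul_sum, sum_weight hPpos hπ, mul_one, hp1]
  -- Replacing only the mixing weights by the mean posterior raises the criterion by at least their
  -- relative entropy. The current weights are optimal, so this entropy is not positive and Gibbs'
  -- inequality applies.
  refine eq_of_sum_mul_log_sub_log_nonpos hπ hpos (hs.1.1.2.2.trans hsum.symm) ?_
  have h1 := em_minorization hp hs hπ (s.2.1, eStep (wavg p) s.1 s.2.2.2) hpos
  have h2 := hs.1.2 (show (s.2.1, eStep (wavg p) s.1 s.2.2.2) ∈ paramSet S M from
    ⟨hs.1.1.1, fun m => (hpos m).le, hsum⟩)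
  simp only [sub_self, Finset.sum_const_zero, add_zero] at h1
  exact h1.trans (sub_nonpos.2 h2)

/-- Minorization with a single type's parameter changed: the mixing-weight terms and the other types
cancel. -/
theorem mObj_sub_le_crit_sub (hp : ∀ w, 0 ≤ p w) (hs : s ∈ fixedPoints S q (wavg p))
    (hπ : ∀ m, 0 < s.1 m) (m : Fin M) (ϑ : Fin d → ℝ) :
    mObj S q (wavg p) s m ϑ - mObj S q (wavg p) s m (s.2.1 m) ≤
      crit S q (wavg p) (Function.update s.2.1 m ϑ, s.1) s.2 -
        crit S q (wavg p) (s.2.1, s.1) s.2 := by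
  refine le_trans (le_of_eq ?_) (em_minorization hp hs hπ (Function.update s.2.1 m ϑ, s.1) hπ)
  simp only [sub_self, mul_zero, Finset.sum_const_zero, zero_add]
  rw [Finset.sum_eq_single m]
  · simp
  · intro m' _ hm'
    simp [Function.update_of_ne hm']
  · simp

omit [Fintype X] [Fintype A] in
theorem update_mem_paramSet {α : Params M d} (hα : α ∈ paramSet S M) (m : Fin M)
    {ϑ : Fin d → ℝ} (hϑ : ϑ ∈ S.Θset) : (Function.update α.1 m ϑ, α.2) ∈ paramSet S M := by
  refine ⟨fun m' => ?_, hα.2⟩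
  by_cases h : m' = m
  · subst h; simpa using hϑ
  · simpa [Function.update_of_ne h] using hα.1 m'

theorem isMaxOn_mObj_of_mem_fixedPoints (hp : ∀ w, 0 ≤ p w) (hs : s ∈ fixedPoints S q (wavg p))
    (hπ : ∀ m, 0 < s.1 m) (m : Fin M) : IsMaxOn (mObj S q (wavg p) s m) S.Θset (s.2.1 m) :=
  fun ϑ hϑ => sub_nonpos.1 ((mObj_sub_le_crit_sub hp hs hπ m ϑ).trans
    (sub_nonpos.2 (hs.1.2 (update_mem_paramSet hs.1.1 m hϑ))))

/-- A fixed point with positive mixing weights is stationary for the EM-NPL algorithm. -/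
theorem isStep_self (hp : ∀ w, 0 ≤ p w) (hp1 : ∑ w, p w = 1)
    (hs : s ∈ fixedPoints S q (wavg p)) (hπ : ∀ m, 0 < s.1 m) : IsStep S q (wavg p) s s :=
  ⟨(eStep_eq_of_mem_fixedPoints hp hp1 hs hπ).symm, fun m => ⟨hs.1.1.1 m,
    isMaxOn_mObj_of_mem_fixedPoints hp hs hπ m, (hs.2 m).2.2.1, (hs.2 m).2.2.2⟩⟩

/-- If the global maximizer of the criterion is unique up to relabelling, then so is the solution
of each M-step. -/
theorem eq_of_isMaxOn_mObj (hp : ∀ w, 0 ≤ p w) (hs : s ∈ fixedPoints S q (wavg p))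
    (hπ : ∀ m, 0 < s.1 m)
    (huniq : ∀ α, IsArgmax S q (wavg p) s.2 α → ∃ σ, α = relabelParams σ (s.2.1, s.1)) (m : Fin M)
    {ϑ : Fin d → ℝ} (hϑ : ϑ ∈ S.Θset) (hmax : IsMaxOn (mObj S q (wavg p) s m) S.Θset ϑ) :
    ϑ = s.2.1 m := by
  have h1 := mObj_sub_le_crit_sub hp hs hπ m ϑ
  have h2 : mObj S q (wavg p) s m (s.2.1 m) ≤ mObj S q (wavg p) s m ϑ := hmax (hs.1.1.1 m)
  have h3 : crit S q (wavg p) (s.2.1, s.1) s.2 ≤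
      crit S q (wavg p) (Function.update s.2.1 m ϑ, s.1) s.2 := by linarith
  -- An alternative M-step solution would also maximize the criterion, hence be a relabelling.
  -- Relabelling preserves the sum over types, and only the entry `m` has changed, so that entry is
  -- unchanged too.
  obtain ⟨σ, hσ⟩ := huniq (Function.update s.2.1 m ϑ, s.1)
    ⟨update_mem_paramSet hs.1.1 m hϑ, fun a ha => (hs.1.2 ha).trans h3⟩
  have h4 : Function.update s.2.1 m ϑ = s.2.1 ∘ σ := congrArg Prod.fst hσ
  have h5 : ∑ m', Function.update s.2.1 m ϑ m' = ∑ m', s.2.1 m' := by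
    rw [h4]; exact Equiv.sum_comp σ s.2.1
  rw [Finset.sum_update_of_mem (Finset.mem_univ m),
    Finset.sum_eq_add_sum_sdiff_singleton m s.2.1 fun h => absurd (Finset.mem_univ m) h] at h5
  exact add_right_cancel h5

end EM

/-! ### The algorithm as a smooth map, and its derivative. -/

section StepMap

variable {M d dY J T : ℕ} {X A : Type*} [Fintype X] [Fintype A] {S : Model d dY J X A} {q : ℕ∞}
  {p₀ : Path T J X A → ℝ} {s₀ : State M d dY J X A}

omit [Fintype X] in
theorem mem_auxSet_of_mem_fixedPoints {avg : (Path T J X A → ℝ) → ℝ} {s : State M d dY J X A}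
    (hs : s ∈ fixedPoints S q avg) : s.2 ∈ auxSet S M :=
  fun m => ⟨hs.1.1.1 m, (hs.2 m).1, (hs.2 m).2.1⟩

omit [Fintype X] in
/-- The first-order condition of the M-step. -/
theorem scoreE_eq_zero {avg : (Path T J X A → ℝ) → ℝ} {s : State M d dY J X A}
    {θ : Fin M → Fin d → ℝ} (hint : ∀ m, θ m ∈ interior S.Θset)
    (hmax : ∀ m, IsMaxOn (mObj S q avg s m) S.Θset (θ m)) :
    scoreE S q avg θ s.2.1 s.2.2.1 s.2.2.2 s.1 = 0 := by
  refine IsLocalMax.fderiv_eq_zero ?_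
  have : ∀ᶠ ϑ in 𝓝 θ, ∀ m, ϑ m ∈ S.Θset := eventually_all.2 fun m =>
    (continuous_apply m).continuousAt.eventually (mem_interior_iff_mem_nhds.1 (hint m))
  -- The objective is a sum over types, so maximizing each term separately maximizes the sum.
  filter_upwards [this] with ϑ hϑ
  exact Finset.sum_le_sum fun m _ => hmax m (hϑ m)

/-- The M-step solution as a smooth function of the weights and of the previous state. -/
theorem exists_mStep (hfix : SameFixedPoint S q) (hs : s₀ ∈ fixedPoints S q (wavg p₀))
    (hreg : Regular S q (wavg p₀) s₀)
    (hmax : ∀ m, IsMaxOn (mObj S q (wavg p₀) s₀ m) S.Θset (s₀.2.1 m)) :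
    ∃ H : (Path T J X A → ℝ) × State M d dY J X A → (Fin M → Fin d → ℝ),
      ContDiffAt ℝ 2 H (p₀, s₀) ∧ H (p₀, s₀) = s₀.2.1 ∧
      (∀ᶠ v : ((Path T J X A → ℝ) × State M d dY J X A) × (Fin M → Fin d → ℝ) in
        𝓝 ((p₀, s₀), s₀.2.1),
        scoreE S q (wavg v.1.1) v.2 v.1.2.2.1 v.1.2.2.2.1 v.1.2.2.2.2 v.1.2.1 = 0 → H v.1 = v.2) ∧
      HasFDerivAt (fun s => H (p₀, s)) (blockRow (Hπ S q (wavg p₀) s₀) (Hθ' S q (wavg p₀) s₀)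
        (HY S q (wavg p₀) s₀) (HP S q (wavg p₀) s₀)) s₀ := by
  set F : ((Path T J X A → ℝ) × State M d dY J X A) × (Fin M → Fin d → ℝ) →
      ((Fin M → Fin d → ℝ) →L[ℝ] ℝ) := fun v =>
    scoreE S q (wavg v.1.1) v.2 v.1.2.2.1 v.1.2.2.2.1 v.1.2.2.2.2 v.1.2.1
  have hFs : ContDiffAt ℝ 2 F ((p₀, s₀), s₀.2.1) := by
    refine ContDiffAt.fderiv (n := 3) (x₀ := ((p₀, s₀), s₀.2.1)) (g := Prod.snd)
      (f := fun (v : ((Path T J X A → ℝ) × State M d dY J X A) × (Fin M → Fin d → ℝ)) θ =>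
        ellE S q (wavg v.1.1) θ v.1.2.2.1 v.1.2.2.2.1 v.1.2.2.2.2 v.1.2.1)
      ?_ contDiffAt_snd (by norm_num)
    refine ellE_contDiffAt hfix hreg (E := (((Path T J X A → ℝ) × State M d dY J X A) ×
      (Fin M → Fin d → ℝ)) × (Fin M → Fin d → ℝ)) (p := fun v => v.1.1.1)
      (u := fun v => v.1.1.2) (ϑ := fun v => v.2) contDiffAt_fst.fst.fst contDiffAt_fst.fst.snd
      contDiffAt_snd (mem_auxSet_of_mem_fixedPoints hs)
      (pos_of_mem_fixedPoints hs) hreg.π_pos hs.1.1.1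
  have hL : HasFDerivAt (fun θ => F ((p₀, s₀), θ)) (hessE S q (wavg p₀) s₀) s₀.2.1 :=
    (hasFDerivAt_snd_slice
      (hFs.differentiableAt (by norm_num)).hasFDerivAt).differentiableAt.hasFDerivAt
  -- The first-order condition is solved for θ with the frequencies and the previous state as
  -- parameters. Splitting its derivative in the state into four partial derivatives gives the
  -- blocks `Hπ`, `Hθ'`, `HY`, `HP`.
  obtain ⟨H, hH, hH0, hHiff, hHd⟩ := exists_implicitFunction hFs (by norm_num)
    (scoreE_eq_zero hreg.θ_interior hmax) hL hreg.hessE_invertible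
  refine ⟨H, hH, hH0, hHiff.mono fun v hv => hv.1, ?_⟩
  have h1 : DifferentiableAt ℝ (fun x => F (x, s₀.2.1)) (p₀, s₀) :=
    (hasFDerivAt_fst_slice (hFs.differentiableAt (by norm_num)).hasFDerivAt).differentiableAt
  have h2 : DifferentiableAt ℝ (fun s => F ((p₀, s), s₀.2.1)) s₀ :=
    (hasFDerivAt_snd_slice h1.hasFDerivAt).differentiableAt
  have h3 := hasFDerivAt_snd_slice hHd
  rw [ContinuousLinearMap.neg_comp, ContinuousLinearMap.comp_assoc,
    ← (hasFDerivAt_snd_slice h1.hasFDerivAt).fderiv] at h3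
  have h4 := fderiv_eq_coprod₄ (f := fun s : State M d dY J X A => F ((p₀, s), s₀.2.1)) h2
  rw [h4] at h3
  convert! h3 using 1
  ext v <;> simp [blockRow, Hπ, Hθ', HY, HP, F]

/-- One iteration of the algorithm, for a given solution `H` of the M-step. -/
def stepMap (S : Model d dY J X A) (q : ℕ∞)
    (H : (Path T J X A → ℝ) × State M d dY J X A → (Fin M → Fin d → ℝ))
    (v : (Path T J X A → ℝ) × State M d dY J X A) : State M d dY J X A :=
  (eStep (wavg v.1) v.2.1 v.2.2.2.2, H v,
    fun m => S.Γ q (H v m) (v.2.2.1 m) (v.2.2.2.2 m) (v.2.2.2.1 m),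
    fun m => S.Λq q (H v m) (v.2.2.1 m) (v.2.2.2.1 m) (v.2.2.2.2 m))

theorem stepMap_contDiffAt (hfix : SameFixedPoint S q) (hs : s₀ ∈ fixedPoints S q (wavg p₀))
    (hreg : Regular S q (wavg p₀) s₀)
    {H : (Path T J X A → ℝ) × State M d dY J X A → (Fin M → Fin d → ℝ)}
    (hH : ContDiffAt ℝ 2 H (p₀, s₀)) (hH0 : H (p₀, s₀) = s₀.2.1) :
    ContDiffAt ℝ 2 (stepMap S q H) (p₀, s₀) := by
  have hz := mem_auxSet_of_mem_fixedPoints hs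
  have hm : ∀ m, H (p₀, s₀) m ∈ S.Θset := by rw [hH0]; exact fun m => (hz m).1
  have hc : ContDiffAt ℝ 2 (fun v : (Path T J X A → ℝ) × State M d dY J X A => v.2) (p₀, s₀) :=
    contDiffAt_snd
  refine ContDiffAt.prodMk (eStep_contDiffAt contDiffAt_fst hc.snd.snd.snd hc.fst
    (pos_of_mem_fixedPoints hs) hreg.π_pos) (hH.prodMk (ContDiffAt.prodMk ?_ ?_))
  · exact contDiffAt_pi.2 fun m => Γ_contDiffAt hreg (by norm_num) (contDiffAt_pi.1 hH m)
      (contDiffAt_pi.1 hc.snd.fst m) (contDiffAt_pi.1 hc.snd.snd.fst m)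
      (contDiffAt_pi.1 hc.snd.snd.snd m) (hm m) (hz m).1 (hz m).2.1 (hz m).2.2
  · exact contDiffAt_pi.2 fun m => Λq_contDiffAt hfix hreg (by norm_num) (contDiffAt_pi.1 hH m)
      (contDiffAt_pi.1 hc.snd.fst m) (contDiffAt_pi.1 hc.snd.snd.fst m)
      (contDiffAt_pi.1 hc.snd.snd.snd m) (hm m) (hz m).1 (hz m).2.1 (hz m).2.2

/-- The derivative of the algorithm at the population fixed point is the rate matrix. -/
theorem stepMap_hasFDerivAt (hfix : SameFixedPoint S q) (hs : s₀ ∈ fixedPoints S q (wavg p₀))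
    (hreg : Regular S q (wavg p₀) s₀)
    {H : (Path T J X A → ℝ) × State M d dY J X A → (Fin M → Fin d → ℝ)}
    (hH0 : H (p₀, s₀) = s₀.2.1)
    (hHd : HasFDerivAt (fun s => H (p₀, s)) (blockRow (Hπ S q (wavg p₀) s₀)
      (Hθ' S q (wavg p₀) s₀) (HY S q (wavg p₀) s₀) (HP S q (wavg p₀) s₀)) s₀) :
    HasFDerivAt (fun s => stepMap S q H (p₀, s)) (rateMatrix S q (wavg p₀) s₀) s₀ := by
  have hz := mem_auxSet_of_mem_fixedPoints hs
  have hθ : ∀ m, HasFDerivAt (fun s : State M d dY J X A => s.2.1 m) _ s₀ := fun m =>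
    hasFDerivAt_pi'.1 (hasFDerivAt_snd (𝕜 := ℝ) (p := s₀)).fst m
  have hY : ∀ m, HasFDerivAt (fun s : State M d dY J X A => s.2.2.1 m) _ s₀ := fun m =>
    hasFDerivAt_pi'.1 (hasFDerivAt_snd (𝕜 := ℝ) (p := s₀)).snd.fst m
  have hP : ∀ m, HasFDerivAt (fun s : State M d dY J X A => s.2.2.2 m) _ s₀ := fun m =>
    hasFDerivAt_pi'.1 (hasFDerivAt_snd (𝕜 := ℝ) (p := s₀)).snd.snd m
  have hH : ∀ m, HasFDerivAt (fun s => H (p₀, s) m) _ s₀ := fun m => hasFDerivAt_pi'.1 hHd m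
  have hE : HasFDerivAt (fun s : State M d dY J X A => eStep (wavg p₀) s.1 s.2.2.2)
      (blockRow (Eπ (wavg p₀) s₀) 0 0 (EP (wavg p₀) s₀)) s₀ := by
    have hd : DifferentiableAt ℝ
        (fun s : State M d dY J X A => eStep (wavg p₀) s.1 s.2.2.2) s₀ :=
      (eStep_contDiffAt (n := 1) (p := fun _ => p₀) contDiffAt_const contDiffAt_snd.snd.snd
        contDiffAt_fst (pos_of_mem_fixedPoints hs) hreg.π_pos).differentiableAt (by norm_num)
    have h := hd.hasFDerivAt
    rw [fderiv_eq_coprod₄ hd] at h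
    convert! h using 1
    ext v <;> simp [blockRow, Eπ, EP]
  refine hE.prodMk (hHd.prodMk (HasFDerivAt.prodMk ?_ ?_))
  · refine hasFDerivAt_pi'.2 fun m => ?_
    -- The chain rule produces the form of the block row: the derivative in the new θ composed with
    -- that of `H`, plus the direct derivatives in the previous state.
    have h := hasFDerivAt_comp₄
      (f := fun u : (Fin d → ℝ) × (Fin d → ℝ) × CCP J X A × (Fin dY → ℝ) =>
      S.Γ q u.1 u.2.1 u.2.2.1 u.2.2.2) (e := s₀)
      (by
        rw [hH0]
        exact (hreg.Γ_smooth _ (hz m).1 _ (hz m).1 _ (hz m).2.1 _ (hz m).2.2).differentiableAt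
          (by norm_num)) (hH m) (hθ m) (hP m) (hY m)
    rw [hH0] at h
    convert! h using 1
    ext v <;> simp [blockRow, blockDiag, Γθ, Γθ', ΓY, ΓP]
  · refine hasFDerivAt_pi'.2 fun m => ?_
    have h := hasFDerivAt_comp₄
      (f := fun u : (Fin d → ℝ) × (Fin d → ℝ) × (Fin dY → ℝ) × CCP J X A =>
      S.Λq q u.1 u.2.1 u.2.2.1 u.2.2.2) (e := s₀)
      (by
        rw [hH0]
        exact (Λq_contDiffAt hfix hreg (n := 1) (by norm_num) contDiffAt_fst contDiffAt_snd.fst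
          contDiffAt_snd.snd.fst contDiffAt_snd.snd.snd (hz m).1 (hz m).1 (hz m).2.1
          (hz m).2.2).differentiableAt (by norm_num)) (hH m) (hθ m) (hY m) (hP m)
    rw [hH0] at h
    convert! h using 1
    ext v <;> simp [blockRow, blockDiag, Λqθ, Λqθ', ΛqY, ΛqP]

/-- Near the population fixed point, every iteration of the algorithm is an application of
`stepMap`. -/
theorem eventually_eq_stepMap (hfix : SameFixedPoint S q) (hs : s₀ ∈ fixedPoints S q (wavg p₀))
    (hreg : Regular S q (wavg p₀) s₀)
    (huniq : ∀ m, ∀ ϑ ∈ S.Θset, IsMaxOn (mObj S q (wavg p₀) s₀ m) S.Θset ϑ → ϑ = s₀.2.1 m)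
    {H : (Path T J X A → ℝ) × State M d dY J X A → (Fin M → Fin d → ℝ)}
    (hHiff : ∀ᶠ v : ((Path T J X A → ℝ) × State M d dY J X A) × (Fin M → Fin d → ℝ) in
        𝓝 ((p₀, s₀), s₀.2.1),
        scoreE S q (wavg v.1.1) v.2 v.1.2.2.1 v.1.2.2.2.1 v.1.2.2.2.2 v.1.2.1 = 0 → H v.1 = v.2) :
    ∀ᶠ v : (Path T J X A → ℝ) × State M d dY J X A in 𝓝 (p₀, s₀), ∀ s',
      IsStep S q (wavg v.1) v.2 s' → s' = stepMap S q H v := by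
  have hz := mem_auxSet_of_mem_fixedPoints hs
  have hint : ∀ᶠ θ : Fin M → Fin d → ℝ in 𝓝 s₀.2.1, ∀ m, θ m ∈ interior S.Θset :=
    eventually_all.2 fun m => (continuous_apply m).continuousAt.eventually
      (isOpen_interior.mem_nhds (hreg.θ_interior m))
  rw [nhds_prod_eq] at hHiff
  obtain ⟨U, hU, V, hV, hUV⟩ := mem_prod_iff.1 hHiff
  obtain ⟨ε, hε, hball⟩ := Metric.mem_nhds_iff.1 (inter_mem hV hint)
  -- Uniqueness at the population values places every global M-step maximizer near the population
  -- parameter. It is therefore interior, satisfies the first-order condition, and must be the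
  -- implicit function `H`.
  have hclose : ∀ m, ∀ᶠ v : (Path T J X A → ℝ) × State M d dY J X A in 𝓝 (p₀, s₀),
      ∀ ϑ ∈ S.Θset, IsMaxOn (mObj S q (wavg v.1) v.2 m) S.Θset ϑ →
        ϑ ∈ Metric.ball (s₀.2.1 m) ε := by
    refine fun m => eventually_isMaxOn_mem hreg.Θ_compact (fun ϑ hϑ => ?_) Metric.isOpen_ball
      fun ϑ hϑ hmax => by rw [huniq m ϑ hϑ hmax]; exact Metric.mem_ball_self hε
    exact (mObj_contDiffAt hfix hreg
      (E := ((Path T J X A → ℝ) × State M d dY J X A) × (Fin d → ℝ)) (p := fun v => v.1.1)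
      (u := fun v => v.1.2) (ϑ := fun v => v.2) contDiffAt_fst.fst contDiffAt_fst.snd
      contDiffAt_snd hz (pos_of_mem_fixedPoints hs) hreg.π_pos hϑ m).continuousAt
  filter_upwards [hU, eventually_all.2 hclose] with v hv hv' s' hs'
  have hmem : s'.2.1 ∈ Metric.ball s₀.2.1 ε := by
    rw [Metric.mem_ball, dist_pi_lt_iff hε]
    exact fun m => hv' m _ (hs'.2 m).1 (hs'.2 m).2.1
  have hH : H v = s'.2.1 := hUV (show (v, s'.2.1) ∈ U ×ˢ V from ⟨hv, (hball hmem).1⟩)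
    (scoreE_eq_zero (hball hmem).2 fun m => (hs'.2 m).2.1)
  refine Prod.ext hs'.1 (Prod.ext hH.symm (Prod.ext ?_ ?_))
  · funext m
    simp only [stepMap, hH]
    exact (hs'.2 m).2.2.1
  · funext m
    simp only [stepMap, hH, Model.Λq]
    rw [← (hs'.2 m).2.2.1]
    exact (hs'.2 m).2.2.2

end StepMap

/-! ### Smooth dependence of maximizers under affine constraints. -/

section ConstrainedMax

variable {E Z : Type*} [NormedAddCommGroup E] [NormedSpace ℝ E] [FiniteDimensional ℝ E]
  [NormedAddCommGroup Z] [NormedSpace ℝ Z] [CompleteSpace Z]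

/-- Maximizers over a set that locally is an affine space depend smoothly on parameters, if the
Hessian is negative definite along that space. -/
theorem exists_smooth_isMaxOn {T : Submodule ℝ E} {K : Set E} {g : Z × E → ℝ} {z₀ : Z} {α₀ : E}
    (hg : ContDiffAt ℝ 3 g (z₀, α₀))
    (hneg : ∀ h ∈ T, h ≠ 0 → fderiv ℝ (fderiv ℝ fun α => g (z₀, α)) α₀ h h < 0)
    (hK : ∀ᶠ α in 𝓝 α₀, α - α₀ ∈ T → α ∈ K) (hKT : ∀ α ∈ K, α - α₀ ∈ T)
    (hα₀ : α₀ ∈ K) (hmax : IsMaxOn (fun α => g (z₀, α)) K α₀) :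
    ∃ a : Z → E, ContDiffAt ℝ 2 a z₀ ∧ a z₀ = α₀ ∧
      ∀ᶠ v in 𝓝 (z₀, α₀), v.2 ∈ K → IsMaxOn (fun α => g (v.1, α)) K v.2 → a v.1 = v.2 := by
  set ι := T.subtypeL
  have hadd : ∀ h : T, HasFDerivAt (fun h : T => α₀ + (h : E)) ι h :=
    fun h => ι.hasFDerivAt.const_add α₀
  have hα₀' : α₀ + ((0 : T) : E) = α₀ := by simp
  set F : Z × T → (T →L[ℝ] ℝ) := fun v => fderiv ℝ (fun h : T => g (v.1, α₀ + (h : E))) v.2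
  have hFs : ContDiffAt ℝ 2 F (z₀, 0) := by
    refine ContDiffAt.fderiv (n := 3) (x₀ := (z₀, (0 : T))) (g := Prod.snd)
      (f := fun (v : Z × T) (h : T) => g (v.1, α₀ + (h : E))) ?_ contDiffAt_snd (by norm_num)
    refine ContDiffAt.comp (g := g) (f := fun v : (Z × T) × T => (v.1.1, α₀ + (v.2 : E)))
      ((z₀, (0 : T)), (0 : T)) (by simpa using hg) (contDiffAt_fst.fst.prodMk ?_)
    exact contDiffAt_const.add (ι.contDiff.contDiffAt.comp _ contDiffAt_snd)
  -- A projection onto `T` gives coordinates on `K` that are defined and continuous on all of `E`.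
  obtain ⟨P, hP⟩ : T.ClosedComplemented :=
    Submodule.ClosedComplemented.of_finiteDimensional_quotient
    T.closed_of_finiteDimensional
  have hPK : ∀ α ∈ K, α₀ + (P (α - α₀) : E) = α := fun α hα => by
    have := hP ⟨α - α₀, hKT α hα⟩
    rw [show P (α - α₀) = ⟨α - α₀, hKT α hα⟩ from this]
    exact add_sub_cancel α₀ α
  have hfoc : ∀ᶠ v in 𝓝 (z₀, α₀), v.2 ∈ K → IsMaxOn (fun α => g (v.1, α)) K v.2 →
      F (v.1, P (v.2 - α₀)) = 0 := by
    have hev : ∀ᶠ v : Z × E in 𝓝 (z₀, α₀), ∀ᶠ α in 𝓝 v.2, α - α₀ ∈ T → α ∈ K :=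
      (continuousAt_snd (p := (z₀, α₀))).eventually hK.eventually_nhds
    filter_upwards [hev] with v hv hvK hvm
    refine IsLocalMax.fderiv_eq_zero ?_
    have hc : Tendsto (fun h : T => α₀ + (h : E)) (𝓝 (P (v.2 - α₀))) (𝓝 v.2) := by
      have := (hadd (P (v.2 - α₀))).continuousAt
      rwa [ContinuousAt, hPK v.2 hvK] at this
    filter_upwards [hc.eventually hv] with h hh
    simp only [hPK v.2 hvK]
    exact hvm (hh (by simp))
  have h0 : F (z₀, 0) = 0 := by
    have := hfoc.self_of_nhds hα₀ hmax
    simpa only [sub_self, map_zero] using this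
  set cr : E → ℝ := fun α => g (z₀, α)
  have hcr : ContDiffAt ℝ 3 cr α₀ :=
    ContDiffAt.comp (g := g) (f := fun α => (z₀, α)) α₀ hg (contDiffAt_const.prodMk contDiffAt_id)
  have hcd : (fun h => F (z₀, h)) =ᶠ[𝓝 0] fun h : T => (fderiv ℝ cr (α₀ + (h : E))).comp ι := by
    have hd : ∀ᶠ α in 𝓝 α₀, DifferentiableAt ℝ cr α :=
      (hcr.eventually (by simp)).mono fun u hu => hu.differentiableAt (by norm_num)
    have hc : Tendsto (fun h : T => α₀ + (h : E)) (𝓝 0) (𝓝 α₀) := by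
      have := (hadd 0).continuousAt
      rwa [ContinuousAt, hα₀'] at this
    filter_upwards [hc.eventually hd] with h hh
    exact (HasFDerivAt.comp (g := cr) (f := fun h : T => α₀ + (h : E)) h hh.hasFDerivAt
      (hadd h)).fderiv
  have hL : HasFDerivAt (fun h => F (z₀, h))
      (((ContinuousLinearMap.compL ℝ T E ℝ).flip ι).comp
        ((fderiv ℝ (fderiv ℝ cr) α₀).comp ι)) 0 := by
    refine HasFDerivAt.congr_of_eventuallyEq ?_ hcd
    have h1 : HasFDerivAt (fderiv ℝ cr) (fderiv ℝ (fderiv ℝ cr) α₀) (α₀ + ((0 : T) : E)) := by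
      rw [hα₀']
      exact ((hcr.fderiv_right (m := 2) (by norm_num)).differentiableAt (by norm_num)).hasFDerivAt
    have h2 := HasFDerivAt.comp (f := fun h : T => α₀ + (h : E)) 0 h1 (hadd 0)
    exact HasFDerivAt.comp (g := fun L => (ContinuousLinearMap.compL ℝ T E ℝ).flip ι L) 0
      (ContinuousLinearMap.hasFDerivAt _) h2
  -- The derivative of the first-order condition along `T` is the Hessian restricted to `T`, which
  -- is definite and so nondegenerate.
  have hinv := isInvertible_of_apply_self_neg (((ContinuousLinearMap.compL ℝ T E ℝ).flip ι).comp
    ((fderiv ℝ (fderiv ℝ cr) α₀).comp ι)) fun h hh => hneg h h.2 (by simpa using hh)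
  obtain ⟨ψ, hψ, hψ0, hψiff, -⟩ := exists_implicitFunction hFs (by norm_num) h0 hL hinv
  refine ⟨fun v => α₀ + (ψ v : E), contDiffAt_const.add (ι.contDiff.contDiffAt.comp _ hψ),
    by simp [hψ0], ?_⟩
  have hc : Tendsto (fun v : Z × E => (v.1, P (v.2 - α₀))) (𝓝 (z₀, α₀)) (𝓝 (z₀, 0)) := by
    have : ContinuousAt (fun v : Z × E => (v.1, P (v.2 - α₀))) (z₀, α₀) := by fun_prop
    simpa only [ContinuousAt, sub_self, map_zero] using this
  filter_upwards [hc.eventually hψiff, hfoc] with v hv hv' hvK hvm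
  have := hv.1 (hv' hvK hvm)
  rw [this, hPK v.2 hvK]

end ConstrainedMax

/-! ### The maximizer of the criterion and the path of fixed points near the population values. -/

section Population

variable {M d dY J T : ℕ} {X A : Type*} [Fintype X] [Fintype A] {S : Model d dY J X A} {q : ℕ∞}
  {p₀ : Path T J X A → ℝ} {s₀ : State M d dY J X A}

/-- The increments of `(θ, π)` along which the mixing weights keep their sum. -/
def tangent (M d : ℕ) : Submodule ℝ (Params M d) where
  carrier := {h | ∑ m, h.2 m = 0}
  add_mem' {a b} ha hb := by
    simp only [Set.mem_ofPred_eq] at ha hb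
    simp [Finset.sum_add_distrib, ha, hb]
  zero_mem' := by simp
  smul_mem' c a ha := by
    simp only [Set.mem_ofPred_eq] at ha
    simp [← Finset.mul_sum, ha]

theorem mem_tangent {h : Params M d} : h ∈ tangent M d ↔ ∑ m, h.2 m = 0 := Iff.rfl

omit [Fintype X] [Fintype A] in
/-- Near a point with interior `θ` and positive weights, `Θ^M × Δ^{M-1}` is an affine space. -/
theorem eventually_mem_paramSet {α₀ : Params M d} (hθ : ∀ m, α₀.1 m ∈ interior S.Θset)
    (hπ : ∀ m, 0 < α₀.2 m) :
    ∀ᶠ α in 𝓝 α₀, ∑ m, α.2 m = 1 → α ∈ paramSet S M := by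
  have h1 : ∀ᶠ α : Params M d in 𝓝 α₀, ∀ m, α.1 m ∈ S.Θset := eventually_all.2 fun m =>
    ((continuous_apply m).comp continuous_fst).continuousAt.eventually
      (mem_interior_iff_mem_nhds.1 (hθ m))
  have h2 : ∀ᶠ α : Params M d in 𝓝 α₀, ∀ m, 0 < α.2 m := eventually_all.2 fun m =>
    ((continuous_apply m).comp continuous_snd).continuousAt.eventually (lt_mem_nhds (hπ m))
  filter_upwards [h1, h2] with α h1 h2 hsum
  exact ⟨h1, fun m => (h2 m).le, hsum⟩

omit [Fintype X] [Fintype A] in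
theorem isCompact_paramSet (hΘ : IsCompact S.Θset) : IsCompact (paramSet S M) := by
  have : paramSet S M = (Set.univ.pi fun _ => S.Θset) ×ˢ stdSimplex ℝ (Fin M) := by
    ext α; simp [paramSet]
  rw [this]
  exact (isCompact_univ_pi fun _ => hΘ).prod (isCompact_stdSimplex ℝ (Fin M))

/-- The maximizers of the criterion near the population parameter form a smooth function of the
weights and of the auxiliary arguments. -/
theorem exists_localArgmax (hfix : SameFixedPoint S q) (hs : s₀ ∈ fixedPoints S q (wavg p₀))
    (hreg : Regular S q (wavg p₀) s₀) :
    ∃ a : (Path T J X A → ℝ) × Aux M d dY J X A → Params M d,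
      ContDiffAt ℝ 2 a (p₀, s₀.2) ∧ a (p₀, s₀.2) = (s₀.2.1, s₀.1) ∧
      ∀ᶠ v : ((Path T J X A → ℝ) × Aux M d dY J X A) × Params M d in
        𝓝 ((p₀, s₀.2), (s₀.2.1, s₀.1)), IsArgmax S q (wavg v.1.1) v.1.2 v.2 → a v.1 = v.2 := by
  have hK : ∀ᶠ α : Params M d in 𝓝 (s₀.2.1, s₀.1),
      α - (s₀.2.1, s₀.1) ∈ tangent M d → α ∈ paramSet S M := by
    filter_upwards [eventually_mem_paramSet (S := S) (α₀ := (s₀.2.1, s₀.1)) hreg.θ_interior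
      hreg.π_pos] with α hα hαT
    refine hα ?_
    have := mem_tangent.1 hαT
    simp only [Prod.snd_sub, Pi.sub_apply, Finset.sum_sub_distrib, hs.1.1.2.2] at this
    linarith
  have hKT : ∀ α ∈ paramSet S M, α - (s₀.2.1, s₀.1) ∈ tangent M d := fun α hα => by
    rw [mem_tangent]
    simp only [Prod.snd_sub, Pi.sub_apply, Finset.sum_sub_distrib, hs.1.1.2.2, hα.2.2, sub_self]
  obtain ⟨a, ha, ha0, hau⟩ := exists_smooth_isMaxOn (T := tangent M d) (K := paramSet S M)
    (g := fun v : ((Path T J X A → ℝ) × Aux M d dY J X A) × Params M d =>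
      crit S q (wavg v.1.1) v.2 v.1.2) (z₀ := (p₀, s₀.2)) (α₀ := (s₀.2.1, s₀.1))
    (crit_contDiffAt hfix hreg contDiffAt_fst.fst contDiffAt_snd contDiffAt_fst.snd hs.1.1
      (mem_auxSet_of_mem_fixedPoints hs))
    (fun h hh hne => hreg.hessian_neg h hne (mem_tangent.1 hh)) hK hKT hs.1.1 hs.1.2
  exact ⟨a, ha, ha0, hau.mono fun v hv h => hv h.1 h.2⟩

theorem relabelParams_inv_cancel (σ : Equiv.Perm (Fin M)) (α : Params M d) :
    relabelParams σ (relabelParams σ⁻¹ α) = α := by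
  refine Prod.ext ?_ ?_ <;> funext m <;> simp [relabelParams]

omit [Fintype X] [Fintype A] in
theorem relabelParams_mem_paramSet (σ : Equiv.Perm (Fin M)) {α : Params M d}
    (hα : α ∈ paramSet S M) : relabelParams σ α ∈ paramSet S M := by
  refine ⟨fun m => hα.1 (σ m), fun m => hα.2.1 (σ m), ?_⟩
  exact (Equiv.sum_comp σ α.2).trans hα.2.2

theorem continuous_relabelParams (σ : Equiv.Perm (Fin M)) :
    Continuous (relabelParams σ : Params M d → Params M d) :=
  (continuous_pi fun m => (continuous_apply (σ m)).comp continuous_fst).prodMk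
    (continuous_pi fun m => (continuous_apply (σ m)).comp continuous_snd)

/-- Near the population values, the criterion has a global maximizer. -/
theorem eventually_exists_isArgmax (hfix : SameFixedPoint S q)
    (hs : s₀ ∈ fixedPoints S q (wavg p₀)) (hreg : Regular S q (wavg p₀) s₀) :
    ∀ᶠ v : (Path T J X A → ℝ) × Aux M d dY J X A in 𝓝 (p₀, s₀.2),
      ∃ α, IsArgmax S q (wavg v.1) v.2 α := by
  have hcomp := isCompact_paramSet (S := S) (M := M) hreg.Θ_compact
  have hcont : ∀ᶠ v : (Path T J X A → ℝ) × Aux M d dY J X A in 𝓝 (p₀, s₀.2),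
      ∀ α ∈ paramSet S M, ContinuousAt (fun a => crit S q (wavg v.1) a v.2) α := by
    refine hcomp.eventually_forall_of_forall_eventually fun α hα => ?_
    have h := crit_contDiffAt hfix hreg
      (E := ((Path T J X A → ℝ) × Aux M d dY J X A) × Params M d) (e := ((p₀, s₀.2), α))
      contDiffAt_fst.fst contDiffAt_snd contDiffAt_fst.snd hα (mem_auxSet_of_mem_fixedPoints hs)
    filter_upwards [h.eventually (by simp)] with v hv
    exact ContinuousAt.comp (f := fun a => (v.1, a)) hv.continuousAt
      (continuousAt_const.prodMk continuousAt_id)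
  filter_upwards [hcont] with v hv
  obtain ⟨α, hα, hmax⟩ := hcomp.exists_isMaxOn ⟨_, hs.1.1⟩
    fun α hα => (hv α hα).continuousWithinAt
  exact ⟨α, hα, hmax⟩

/-- The local maximizer of the criterion is a global one. -/
theorem eventually_isArgmax (hfix : SameFixedPoint S q) (hs : s₀ ∈ fixedPoints S q (wavg p₀))
    (hreg : Regular S q (wavg p₀) s₀)
    {a : (Path T J X A → ℝ) × Aux M d dY J X A → Params M d}
    (hau : ∀ᶠ v : ((Path T J X A → ℝ) × Aux M d dY J X A) × Params M d in
        𝓝 ((p₀, s₀.2), (s₀.2.1, s₀.1)), IsArgmax S q (wavg v.1.1) v.1.2 v.2 → a v.1 = v.2) :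
    ∀ᶠ v : (Path T J X A → ℝ) × Aux M d dY J X A in 𝓝 (p₀, s₀.2),
      IsArgmax S q (wavg v.1) v.2 (a v) := by
  obtain ⟨V, hV, huniq⟩ := hreg.argmax_unique
  rw [nhds_prod_eq] at hau
  obtain ⟨U, hU, O, hO, hUO⟩ := mem_prod_iff.1 hau
  obtain ⟨O', hO'O, hO', hαO'⟩ := mem_nhds_iff.1 hO
  -- `B` collects the images of `O'` under the label permutations that are symmetries of the
  -- likelihood on `V`. Nearby global maximizers lie in `B`; undoing the permutation brings them
  -- into `O'`, where they must coincide with `a v`.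
  set B : Set (Params M d) := {α | ∃ σ : Equiv.Perm (Fin M), (∀ z' ∈ V, ∀ β ∈ paramSet S M,
    ∀ w : Path T J X A, mixLik S q (relabelParams σ β) z' w = mixLik S q β z' w) ∧
    relabelParams σ⁻¹ α ∈ O'} with hB
  have hBo : IsOpen B := by
    have : B = ⋃ σ ∈ {σ : Equiv.Perm (Fin M) | ∀ z' ∈ V, ∀ β ∈ paramSet S M,
        ∀ w : Path T J X A, mixLik S q (relabelParams σ β) z' w = mixLik S q β z' w},
        relabelParams σ⁻¹ ⁻¹' O' := by
      ext α; simp [hB]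
    rw [this]
    exact isOpen_biUnion fun σ _ => hO'.preimage (continuous_relabelParams _)
  have hmem := eventually_isMaxOn_mem (u₀ := (p₀, s₀.2)) (O := B)
    (g := fun (v : (Path T J X A → ℝ) × Aux M d dY J X A) α => crit S q (wavg v.1) α v.2)
    (isCompact_paramSet (S := S) (M := M) hreg.Θ_compact)
    (fun α hα => (crit_contDiffAt hfix hreg
      (E := ((Path T J X A → ℝ) × Aux M d dY J X A) × Params M d) (e := ((p₀, s₀.2), α))
      contDiffAt_fst.fst contDiffAt_snd contDiffAt_fst.snd hα
      (mem_auxSet_of_mem_fixedPoints hs)).continuousAt) hBo (fun α hα hmax => ?_)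
  · have hVv : ∀ᶠ v : (Path T J X A → ℝ) × Aux M d dY J X A in 𝓝 (p₀, s₀.2), v.2 ∈ V :=
      (continuousAt_snd (p := (p₀, s₀.2))).eventually hV
    filter_upwards [hmem, hVv, hU, eventually_exists_isArgmax hfix hs hreg] with v hv hvV hvU hex
    obtain ⟨α, hα⟩ := hex
    obtain ⟨σ, hσ, hσO⟩ := hv α hα.1 hα.2
    have hmem' := relabelParams_mem_paramSet σ⁻¹ hα.1
    -- The symmetry holds history by history, so it survives the passage from `p₀` to other weights.
    have hcrit : crit S q (wavg v.1) α v.2 = crit S q (wavg v.1) (relabelParams σ⁻¹ α) v.2 := by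
      have := hσ v.2 hvV _ hmem'
      rw [relabelParams_inv_cancel] at this
      simp only [crit, this]
    have harg : IsArgmax S q (wavg v.1) v.2 (relabelParams σ⁻¹ α) :=
      ⟨hmem', fun b hb => (hα.2 hb).trans hcrit.le⟩
    have := hUO (show (v, relabelParams σ⁻¹ α) ∈ U ×ˢ O from ⟨hvU, hO'O hσO⟩) harg
    simp only at this
    rwa [this]
  · obtain ⟨σ, hσ, hinv⟩ := huniq s₀.2 (mem_of_mem_nhds hV) _ α hs.1 ⟨hα, hmax⟩
    refine ⟨σ, hinv, ?_⟩
    have : relabelParams σ⁻¹ α = (s₀.2.1, s₀.1) := by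
      rw [hσ]
      refine Prod.ext ?_ ?_ <;> funext m <;> simp [relabelParams]
    rwa [this]

/-- Near the population fixed point there is exactly one fixed point for each choice of the
weights, and it depends smoothly on them. -/
theorem exists_fixedPoint_path (hfix : SameFixedPoint S q) (hs : s₀ ∈ fixedPoints S q (wavg p₀))
    (hreg : Regular S q (wavg p₀) s₀) :
    ∃ ξ : (Path T J X A → ℝ) → State M d dY J X A, ContDiffAt ℝ 2 ξ p₀ ∧ ξ p₀ = s₀ ∧
      (∀ᶠ p in 𝓝 p₀, ξ p ∈ fixedPoints S q (wavg p)) ∧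
      ∀ᶠ v : (Path T J X A → ℝ) × State M d dY J X A in 𝓝 (p₀, s₀),
        v.2 ∈ fixedPoints S q (wavg v.1) → ξ v.1 = v.2 := by
  have hz := mem_auxSet_of_mem_fixedPoints hs
  obtain ⟨a, ha, ha0, hau⟩ := exists_localArgmax hfix hs hreg
  have harg := eventually_isArgmax hfix hs hreg hau
  have ham : ∀ m, (a (p₀, s₀.2)).1 m ∈ S.Θset := fun m => by rw [ha0]; exact (hz m).1
  -- Fixed points near `s₀` are zeros of φ_q - id, with the local maximizer `a` in place of the
  -- selection of `phi_regular`. Both selections agree near the population value, so the assumed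
  -- Jacobian is that of `f`.
  set f : (Path T J X A → ℝ) × Aux M d dY J X A → Aux M d dY J X A := fun v =>
    phi S q (fun z => a (v.1, z)) v.2 - v.2
  have hc : ContDiffAt ℝ 2 (fun v : (Path T J X A → ℝ) × Aux M d dY J X A => v.2) (p₀, s₀.2) :=
    contDiffAt_snd
  have hfs : ContDiffAt ℝ 2 f (p₀, s₀.2) := by
    refine ContDiffAt.sub (ha.fst.prodMk (ContDiffAt.prodMk ?_ ?_)) hc
    · exact contDiffAt_pi.2 fun m => Γ_contDiffAt hreg (by norm_num) (contDiffAt_pi.1 ha.fst m)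
        (contDiffAt_pi.1 hc.fst m) (contDiffAt_pi.1 hc.snd.fst m)
        (contDiffAt_pi.1 hc.snd.snd m) (ham m) (hz m).1 (hz m).2.1 (hz m).2.2
    · exact contDiffAt_pi.2 fun m => Λq_contDiffAt hfix hreg (by norm_num)
        (contDiffAt_pi.1 ha.fst m) (contDiffAt_pi.1 hc.fst m) (contDiffAt_pi.1 hc.snd.fst m)
        (contDiffAt_pi.1 hc.snd.snd m) (ham m) (hz m).1 (hz m).2.1 (hz m).2.2
  have hphi : ∀ (p : Path T J X A → ℝ) (s : State M d dY J X A),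
      s ∈ fixedPoints S q (wavg p) → a (p, s.2) = (s.2.1, s.1) → f (p, s.2) = 0 := by
    intro p s hsp has
    refine sub_eq_zero.2 (Prod.ext ?_ (Prod.ext ?_ ?_))
    · simp [phi, has]
    · funext m; simp only [phi, has]; exact (hsp.2 m).2.2.1.symm
    · funext m; simp only [phi, has]; rw [← (hsp.2 m).2.2.1]; exact (hsp.2 m).2.2.2.symm
  obtain ⟨α, hα, hα0, hαc, D, hD, hDinv⟩ := hreg.phi_regular
  have hαa : ∀ᶠ z in 𝓝 s₀.2, α z = a (p₀, z) := by
    have h1 : Tendsto (fun z => (((p₀, z), α z) :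
        ((Path T J X A → ℝ) × Aux M d dY J X A) × Params M d)) (𝓝 s₀.2)
        (𝓝 ((p₀, s₀.2), (s₀.2.1, s₀.1))) := by
      have : ContinuousAt (fun z => (((p₀, z), α z) :
        ((Path T J X A → ℝ) × Aux M d dY J X A) × Params M d)) s₀.2 :=
        (continuousAt_const.prodMk continuousAt_id).prodMk hαc
      rwa [ContinuousAt, hα0] at this
    filter_upwards [h1.eventually hau, hα] with z hz1 hz2
    exact (hz1 hz2).symm
  have hL : HasFDerivAt (fun z => f (p₀, z)) (D - ContinuousLinearMap.id ℝ _) s₀.2 := by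
    refine (hD.congr_of_eventuallyEq ?_).sub (hasFDerivAt_id s₀.2)
    filter_upwards [hαa] with z hz
    simp only [phi, hz]
  obtain ⟨ζ, hζ, hζ0, hζiff, -⟩ := exists_implicitFunction hfs (by norm_num)
    (hphi p₀ s₀ hs ha0) hL hDinv
  have hζc : Tendsto (fun p => (p, ζ p)) (𝓝 p₀) (𝓝 (p₀, s₀.2)) := by
    have : ContinuousAt (fun p => (p, ζ p)) p₀ := continuousAt_id.prodMk hζ.continuousAt
    rwa [ContinuousAt, hζ0] at this
  have hζt : Tendsto ζ (𝓝 p₀) (𝓝 s₀.2) := (continuous_snd.tendsto (p₀, s₀.2)).comp hζc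
  -- The map φ_q does not carry the mixing weights; they are read off from the maximizer.
  refine ⟨fun p => ((a (p, ζ p)).2, ζ p), ?_, by simp [hζ0, ha0], ?_, ?_⟩
  · have ha' : ContDiffAt ℝ 2 a (p₀, ζ p₀) := by rwa [hζ0]
    exact (ha'.comp (f := fun p => (p, ζ p)) p₀ (contDiffAt_id.prodMk hζ)).snd.prodMk hζ
  · have hA : ∀ (_ : Fin J) (_ : X), Nonempty A := by
      obtain ⟨m⟩ := nonempty_of_mem_fixedPoints hs
      intro j x
      by_contra h
      rw [not_nonempty_iff] at h
      have := (hreg.P_subset (hz m).2.2 j x).2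
      simp at this
    have hYm : ∀ᶠ z : Aux M d dY J X A in 𝓝 s₀.2, ∀ m, z.2.1 m ∈ S.Yset :=
      eventually_all.2 fun m => ((continuous_apply m).comp
        (continuous_fst.comp continuous_snd)).continuousAt.eventually
          (mem_interior_iff_mem_nhds.1 (hreg.Y_interior m))
    -- `S.Pset` is only a relative neighbourhood. This suffices because the `P` of a zero is a logit
    -- profile, hence a choice-probability profile.
    have hPm : ∀ᶠ z : Aux M d dY J X A in 𝓝 s₀.2, ∀ m, z.2.2 m ∈ ccpSet J X A → z.2.2 m ∈ S.Pset :=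
      eventually_all.2 fun m => ((continuous_apply m).comp
        (continuous_snd.comp continuous_snd)).continuousAt.eventually
          (mem_nhdsWithin_iff_eventually.1 (hreg.P_interior m))
    filter_upwards [hζc.eventually hζiff, hζc.eventually harg, hζt.eventually hYm,
      hζt.eventually hPm] with p h1 h2 h3 h4
    have hfp : phi S q (fun z => a (p, z)) (ζ p) = ζ p := sub_eq_zero.1 (h1.2 rfl)
    have hθ : (a (p, ζ p)).1 = (ζ p).1 := congrArg Prod.fst hfp
    have hY : ∀ m, (ζ p).2.1 m = S.Γ q ((ζ p).1 m) ((ζ p).1 m) ((ζ p).2.2 m) ((ζ p).2.1 m) := by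
      intro m
      have := congrFun (congrArg (fun z => z.2.1) hfp) m
      simp only [phi, hθ] at this
      exact this.symm
    have hP : ∀ m, (ζ p).2.2 m = S.Λ ((ζ p).1 m) ((ζ p).2.1 m) ((ζ p).2.2 m) := by
      intro m
      have := congrFun (congrArg (fun z => z.2.2) hfp) m
      simp only [phi, hθ, ← hY] at this
      exact this.symm
    refine ⟨?_, fun m => ⟨h3 m, h4 m ?_, hY m, hP m⟩⟩
    · have : ((ζ p).1, (a (p, ζ p)).2) = a (p, ζ p) := Prod.ext hθ.symm rfl
      simp only [this]
      exact h2
    · rw [hP m]; exact S.Λ_mem_ccpSet hA _ _ _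
  · have h1 : Tendsto (fun v : (Path T J X A → ℝ) × State M d dY J X A =>
        ((v.1, v.2.2), (v.2.2.1, v.2.1))) (𝓝 (p₀, s₀)) (𝓝 ((p₀, s₀.2), (s₀.2.1, s₀.1))) :=
      Continuous.tendsto (by fun_prop) (p₀, s₀)
    have h2 : Tendsto (fun v : (Path T J X A → ℝ) × State M d dY J X A => (v.1, v.2.2))
        (𝓝 (p₀, s₀)) (𝓝 (p₀, s₀.2)) := Continuous.tendsto (by fun_prop) (p₀, s₀)
    filter_upwards [h1.eventually hau, h2.eventually hζiff] with v hv1 hv2 hv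
    have e1 := hv1 hv.1
    have e2 := hv2.1 (hphi v.1 v.2 hv e1)
    exact Prod.ext (by simp only [e2, e1]) e2

end Population

/-! ### Consistency of the estimators, and the deterministic expansion. -/

section Consistency

variable {M d dY J T : ℕ} {X A : Type*} [Fintype X] [Fintype A] {S : Model d dY J X A} {q : ℕ∞}
  {p₀ : Path T J X A → ℝ} {s₀ : State M d dY J X A}

omit [Fintype X] [Fintype A] in
theorem continuous_relabel (σ : Equiv.Perm (Fin M)) :
    Continuous (relabel σ : State M d dY J X A → State M d dY J X A) := by
  unfold relabel
  refine Continuous.prodMk ?_ (Continuous.prodMk ?_ (Continuous.prodMk ?_ ?_)) <;>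
    exact continuous_pi fun m => (continuous_apply (σ m)).comp (by fun_prop)

omit [Fintype X] in
/-- All fixed points lie in a compact set on which the equations for `Y` hold. -/
theorem exists_isCompact_fixedPoints (hfix : SameFixedPoint S q) (hΘ : IsCompact S.Θset)
    (hP : IsCompact S.Pset) :
    ∃ K : Set (State M d dY J X A), IsCompact K ∧
      (∀ avg : (Path T J X A → ℝ) → ℝ, fixedPoints S q avg ⊆ K) ∧
      ∀ s ∈ K, (s.2.1, s.1) ∈ paramSet S M ∧ s.2 ∈ auxSet S M ∧
        ∀ m, s.2.2.1 m = S.Γ q (s.2.1 m) (s.2.1 m) (s.2.2.2 m) (s.2.2.1 m) := by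
  -- No compactness of `S.Yset` is assumed. Instead `Y` is a continuous function of `(θ, P)` at a
  -- fixed point, so fixed points lie on a graph over a compact set. Off the domain the solution
  -- gets the default value 0.
  have hex : ∀ u : (Fin d → ℝ) × (Fin d → ℝ) × CCP J X A, ∃ Y, u ∈ S.Θset ×ˢ S.Θset ×ˢ S.Pset →
      Y ∈ S.Yset ∧ Y = S.G u.1 u.2.1 Y u.2.2 := by
    intro u
    by_cases hu : u ∈ S.Θset ×ˢ S.Θset ×ˢ S.Pset
    · obtain ⟨Y, hY, -⟩ := hfix.existsUnique _ hu.1 _ hu.2.1 _ hu.2.2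
      exact ⟨Y, fun _ => hY⟩
    · exact ⟨0, fun h => absurd h hu⟩
  choose Ysol hYsol using hex
  have hcont := hfix.continuous Ysol fun θ hθ θ' hθ' P hP => hYsol _ ⟨hθ, hθ', hP⟩
  set D : Set ((Fin M → ℝ) × (Fin M → Fin d → ℝ) × (Fin M → CCP J X A)) :=
    stdSimplex ℝ (Fin M) ×ˢ (Set.univ.pi fun _ => S.Θset) ×ˢ (Set.univ.pi fun _ => S.Pset)
  have hDc : IsCompact D := (isCompact_stdSimplex ℝ (Fin M)).prod
    ((isCompact_univ_pi fun _ => hΘ).prod (isCompact_univ_pi fun _ => hP))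
  set c : (Fin M → ℝ) × (Fin M → Fin d → ℝ) × (Fin M → CCP J X A) → State M d dY J X A :=
    fun u => (u.1, u.2.1, fun m => Ysol (u.2.1 m, u.2.1 m, u.2.2 m), u.2.2)
  have hcc : ContinuousOn c D := by
    refine continuousOn_fst.prodMk (ContinuousOn.prodMk (by fun_prop)
      (ContinuousOn.prodMk (continuousOn_pi.2 fun m => ?_) (by fun_prop)))
    refine hcont.comp (f := fun u : (Fin M → ℝ) × (Fin M → Fin d → ℝ) × (Fin M → CCP J X A) =>
      (u.2.1 m, u.2.1 m, u.2.2 m)) (Continuous.continuousOn (by fun_prop)) fun u hu => ?_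
    exact ⟨hu.2.1 m trivial, hu.2.1 m trivial, hu.2.2 m trivial⟩
  refine ⟨c '' D, hDc.image_of_continuousOn hcc, fun avg s hs => ?_, ?_⟩
  · refine ⟨(s.1, s.2.1, s.2.2.2), ⟨hs.1.1.2, fun m _ => hs.1.1.1 m, fun m _ => (hs.2 m).2.1⟩, ?_⟩
    refine Prod.ext rfl (Prod.ext rfl (Prod.ext ?_ rfl))
    funext m
    obtain ⟨hY, hPm, hΓ, -⟩ := hs.2 m
    have hθ := hs.1.1.1 m
    obtain ⟨Y, -, hu⟩ := hfix.existsUnique _ hθ _ hθ _ hPm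
    exact (hu _ (hYsol _ ⟨hθ, hθ, hPm⟩)).trans
      (hu _ ⟨hY, (hfix.same _ hθ _ hθ _ hPm _ hY).1 hΓ⟩).symm
  · rintro _ ⟨u, hu, rfl⟩
    have hθ : ∀ m, u.2.1 m ∈ S.Θset := fun m => hu.2.1 m trivial
    have hPm : ∀ m, u.2.2 m ∈ S.Pset := fun m => hu.2.2 m trivial
    have hY := fun m => hYsol (u.2.1 m, u.2.1 m, u.2.2 m) ⟨hθ m, hθ m, hPm m⟩
    exact ⟨⟨hθ, hu.1⟩, fun m => ⟨hθ m, (hY m).1, hPm m⟩, fun m =>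
      (hfix.same _ (hθ m) _ (hθ m) _ (hPm m) _ (hY m).1).2 (hY m).2⟩

/-- Consistency of the estimators, as the weights approach the population weights. -/
theorem eventually_norm_estimator_sub_lt (hfix : SameFixedPoint S q)
    (hid : Identified S q (wavg p₀) s₀) (hreg : Regular S q (wavg p₀) s₀)
    {ξ : (Path T J X A → ℝ) → State M d dY J X A} (hξ : ContinuousAt ξ p₀) (hξ0 : ξ p₀ = s₀)
    (hξfix : ∀ᶠ p in 𝓝 p₀, ξ p ∈ fixedPoints S q (wavg p)) {ε : ℝ} (hε : 0 < ε) :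
    ∀ᶠ p in 𝓝 p₀, ∀ s, IsEstimator S q (wavg p) s →
      (∀ σ, ‖s - s₀‖ ≤ ‖relabel σ s - s₀‖) → ‖s - s₀‖ < ε := by
  have hs := hid.isEstimator.1
  obtain ⟨K, hK, hKfix, hKdom⟩ := exists_isCompact_fixedPoints (M := M) (T := T) hfix
    hreg.Θ_compact hreg.P_compact
  have hcritc : ∀ s ∈ K, ContinuousAt
      (fun v : (Path T J X A → ℝ) × State M d dY J X A => critAt S q (wavg v.1) v.2) (p₀, s) :=
    fun s hsK => (crit_contDiffAt hfix hreg (E := (Path T J X A → ℝ) × State M d dY J X A)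
      (α := fun v => (v.2.2.1, v.2.1)) (z := fun v => v.2.2) (e := (p₀, s)) contDiffAt_fst
      (contDiffAt_snd.snd.fst.prodMk contDiffAt_snd.fst) contDiffAt_snd.snd
      (hKdom s hsK).1 (hKdom s hsK).2.1).continuousAt
  -- By compactness it is enough to exclude estimators near each `s` in `K` that has no labelling
  -- close to `s₀`. Such an `s` is not a population estimator, and each way of failing persists
  -- under perturbation.
  have key : ∀ᶠ p in 𝓝 p₀, ∀ s ∈ K, IsEstimator S q (wavg p) s → ∃ σ, ‖relabel σ s - s₀‖ < ε := by
    refine hK.eventually_forall_of_forall_eventually fun s hsK => ?_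
    obtain ⟨hα, hz, hY⟩ := hKdom s hsK
    by_cases hB : ∃ σ, ‖relabel σ s - s₀‖ < ε
    · obtain ⟨σ, hσ⟩ := hB
      have hc : ContinuousAt (fun v : (Path T J X A → ℝ) × State M d dY J X A =>
          ‖relabel σ v.2 - s₀‖) (p₀, s) :=
        (((continuous_relabel σ).comp continuous_snd).sub continuous_const).norm.continuousAt
      filter_upwards [hc.eventually_lt continuousAt_const hσ] with v hv _
      exact ⟨σ, hv⟩
    have hne : ¬ IsEstimator S q (wavg p₀) s := by
      intro h
      obtain ⟨σ, hσ⟩ := hid.unique s h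
      refine hB ⟨σ⁻¹, ?_⟩
      have : relabel σ⁻¹ s = s₀ := by
        rw [hσ]
        refine Prod.ext ?_ (Prod.ext ?_ (Prod.ext ?_ ?_)) <;> funext m <;> simp [relabel]
      simpa [this] using hε
    suffices ∀ᶠ v : (Path T J X A → ℝ) × State M d dY J X A in 𝓝 (p₀, s),
        ¬ IsEstimator S q (wavg v.1) v.2 from this.mono fun v hv h => absurd h hv
    by_cases hf : s ∈ fixedPoints S q (wavg p₀)
    -- A suboptimal fixed point: the path `ξ` supplies a better fixed point for the perturbed
    -- weights as well, which `s₀` alone would not.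
    · have hlt : critAt S q (wavg p₀) s < critAt S q (wavg p₀) (ξ p₀) := by
        by_contra! hge
        exact hne ⟨hf, fun s' hs' => (hid.isEstimator.2 hs').trans (hξ0 ▸ hge)⟩
      have hξc : ContinuousAt (fun v : (Path T J X A → ℝ) × State M d dY J X A =>
          critAt S q (wavg v.1) (ξ v.1)) (p₀, s) := by
        have h1 : ContinuousAt (fun p => critAt S q (wavg p) (ξ p)) p₀ :=
          ContinuousAt.comp (f := fun p => (p, ξ p))
            (g := fun v : (Path T J X A → ℝ) × State M d dY J X A => critAt S q (wavg v.1) v.2)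
            (by rw [hξ0]; exact hcritc s₀ (hKfix _ hs)) (continuousAt_id.prodMk hξ)
        exact ContinuousAt.comp (f := Prod.fst) (x := (p₀, s)) h1 continuousAt_fst
      have hξfix' : ∀ᶠ v : (Path T J X A → ℝ) × State M d dY J X A in 𝓝 (p₀, s),
          ξ v.1 ∈ fixedPoints S q (wavg v.1) :=
        (continuousAt_fst (p := (p₀, s))).eventually hξfix
      filter_upwards [(hcritc s hsK).eventually_lt hξc hlt, hξfix'] with v hv hv' hest
      exact absurd (hest.2 hv') (not_le.2 hv)
    by_cases ha : IsArgmax S q (wavg p₀) s.2 (s.2.1, s.1)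
    · have : ∃ m, s.2.2.2 m ≠ S.Λ (s.2.1 m) (s.2.2.1 m) (s.2.2.2 m) := by
        by_contra! h
        exact hf ⟨ha, fun m => ⟨(hz m).2.1, (hz m).2.2, hY m, h m⟩⟩
      obtain ⟨m, hm⟩ := this
      have h1 : ContinuousAt (fun v : (Path T J X A → ℝ) × State M d dY J X A => v.2.2.2.2 m)
        (p₀, s) := Continuous.continuousAt (by fun_prop)
      have h2 : ContinuousAt (fun v : (Path T J X A → ℝ) × State M d dY J X A =>
          S.Λ (v.2.2.1 m) (v.2.2.2.1 m) (v.2.2.2.2 m)) (p₀, s) :=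
        ContinuousAt.comp (g := fun u : (Fin d → ℝ) × (Fin dY → ℝ) × CCP J X A =>
            S.Λ u.1 u.2.1 u.2.2)
          (f := fun v : (Path T J X A → ℝ) × State M d dY J X A =>
            (v.2.2.1 m, v.2.2.2.1 m, v.2.2.2.2 m))
          (hreg.Λ_smooth _ (hz m).1 _ (hz m).2.1 _ (hz m).2.2).continuousAt
          (Continuous.continuousAt (by fun_prop))
      filter_upwards [(h1.ne_iff_eventually_ne h2).1 hm] with v hv hest
      exact hv (hest.1.2 m).2.2.2
    · have : ∃ β ∈ paramSet S M, critAt S q (wavg p₀) s < crit S q (wavg p₀) β s.2 := by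
        by_contra! h
        exact ha ⟨hα, h⟩
      obtain ⟨β, hβ, hlt⟩ := this
      have h1 : ContinuousAt (fun v : (Path T J X A → ℝ) × State M d dY J X A =>
          crit S q (wavg v.1) β v.2.2) (p₀, s) :=
        (crit_contDiffAt hfix hreg (E := (Path T J X A → ℝ) × State M d dY J X A)
          (α := fun _ => β) (z := fun v => v.2.2) (e := (p₀, s)) contDiffAt_fst
          contDiffAt_const contDiffAt_snd.snd hβ hz).continuousAt
      filter_upwards [(hcritc s hsK).eventually_lt h1 hlt] with v hv hest
      exact absurd (hest.1.1.2 hβ) (not_le.2 hv)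
  filter_upwards [key] with p hp s hest hσ
  obtain ⟨σ, h⟩ := hp s (hKfix _ hest.1) hest
  exact (hσ σ).trans_lt h

/-- The deterministic content of the theorem: if the weights are close to the population weights,
then the estimator is close to the population fixed point, and every iteration from a state close
to the estimator satisfies the expansion. -/
theorem exists_uniform_expansion (hfix : SameFixedPoint S q) (hp₀ : ∀ w, 0 ≤ p₀ w)
    (hid : Identified S q (wavg p₀) s₀) (hreg : Regular S q (wavg p₀) s₀) :
    ∃ r > 0, ∃ C ≥ 0, ∀ᶠ p in 𝓝 p₀, (∀ w, 0 ≤ p w) → ∑ w, p w = 1 → ∀ sh,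
      IsEstimator S q (wavg p) sh → (∀ σ, ‖sh - s₀‖ ≤ ‖relabel σ sh - s₀‖) →
      ‖sh - s₀‖ ≤ C * ‖p - p₀‖ ∧ ∀ s s', ‖s - sh‖ ≤ r → IsStep S q (wavg p) s s' →
        ‖(s' - sh) - rateMatrix S q (wavg p₀) s₀ (s - sh)‖ ≤
          C * (‖p - p₀‖ * ‖s - sh‖ + ‖s - sh‖ ^ 2) := by
  have hs := hid.isEstimator.1
  have huniq : ∀ α, IsArgmax S q (wavg p₀) s₀.2 α → ∃ σ, α = relabelParams σ (s₀.2.1, s₀.1) := by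
    obtain ⟨V, hV, h⟩ := hreg.argmax_unique
    intro α hα
    obtain ⟨σ, hσ, -⟩ := h s₀.2 (mem_of_mem_nhds hV) _ α hs.1 hα
    exact ⟨σ, hσ⟩
  have huniq' : ∀ m, ∀ ϑ ∈ S.Θset, IsMaxOn (mObj S q (wavg p₀) s₀ m) S.Θset ϑ → ϑ = s₀.2.1 m :=
    fun m ϑ hϑ hm => eq_of_isMaxOn_mObj hp₀ hs hreg.π_pos huniq m hϑ hm
  have hmax : ∀ m, IsMaxOn (mObj S q (wavg p₀) s₀ m) S.Θset (s₀.2.1 m) :=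
    isMaxOn_mObj_of_mem_fixedPoints hp₀ hs hreg.π_pos
  obtain ⟨ξ, hξ, hξ0, hξfix, hξu⟩ := exists_fixedPoint_path hfix hs hreg
  obtain ⟨H, hH, hH0, hHu, hHd⟩ := exists_mStep hfix hs hreg hmax
  have hstep := eventually_eq_stepMap hfix hs hreg huniq' hHu
  obtain ⟨K, hK, ρ, hρ, hexp⟩ := exists_expansion (stepMap_contDiffAt hfix hs hreg hH hH0)
    (stepMap_hasFDerivAt hfix hs hreg hH0 hHd)
  obtain ⟨L, U, hU, hlip⟩ := (hξ.of_le (by norm_num : (1 : WithTop ℕ∞) ≤ 2)).exists_lipschitzOnWith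
  have hπ : ∀ᶠ v : (Path T J X A → ℝ) × State M d dY J X A in 𝓝 (p₀, s₀), ∀ m, 0 < v.2.1 m :=
    eventually_all.2 fun m => continuousAt_const.eventually_lt
      (g := fun v : (Path T J X A → ℝ) × State M d dY J X A => v.2.1 m)
      (Continuous.continuousAt (by fun_prop)) (hreg.π_pos m)
  obtain ⟨η, hη, hball⟩ := Metric.mem_nhds_iff.1 ((hstep.and hξu).and hπ)
  have hmin : 0 < min ρ η / 2 := by positivity
  -- A quarter for `s - sh` and a half for `sh - s₀` keep `s` inside the radius `min ρ η`. The
  -- constant dominates `L` (the rate of `sh`), `K * (L + 1)` (the mixed term) and `K` (the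
  -- quadratic term).
  refine ⟨min ρ η / 4, by positivity, K * (L + 1) + L, by positivity, ?_⟩
  filter_upwards [eventually_norm_estimator_sub_lt hfix hid hreg hξ.continuousAt hξ0 hξfix hmin,
    Metric.ball_mem_nhds p₀ hmin, hU] with p hcons hpball hpU hp hp1 sh hest hσ
  rw [mem_ball_iff_norm] at hpball
  have hsh := hcons sh hest hσ
  have hmρ : min ρ η ≤ ρ := min_le_left _ _
  have hmη : min ρ η ≤ η := min_le_right _ _
  have hin : ∀ s : State M d dY J X A, ‖s - s₀‖ < min ρ η →
      (p, s) ∈ Metric.ball (p₀, s₀) η := fun s hs => by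
    rw [mem_ball_iff_norm, Prod.norm_def]
    exact max_lt (by simp only [Prod.fst_sub]; linarith) (by simp only [Prod.snd_sub]; linarith)
  have hrate : ‖sh - s₀‖ ≤ L * ‖p - p₀‖ := by
    have h1 : ξ p = sh := (hball (hin sh (by linarith))).1.2 hest.1
    have h2 := hlip.dist_le_mul _ hpU _ (mem_of_mem_nhds hU)
    rwa [dist_eq_norm, dist_eq_norm, h1, hξ0] at h2
  have hn : 0 ≤ ‖p - p₀‖ := norm_nonneg _
  have hL0 : (0 : ℝ) ≤ L := L.2
  refine ⟨hrate.trans ?_, fun s s' hsr hss' => ?_⟩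
  · have : 0 ≤ K * (L + 1) := by positivity
    exact mul_le_mul_of_nonneg_right (by linarith) hn
  have hs0 : ‖s - s₀‖ < min ρ η := by
    calc ‖s - s₀‖ = ‖(s - sh) + (sh - s₀)‖ := by congr 1; abel
      _ ≤ ‖s - sh‖ + ‖sh - s₀‖ := norm_add_le _ _
      _ < _ := by linarith
  have e1 : s' = stepMap S q H (p, s) := (hball (hin s hs0)).1.1 s' hss'
  -- The estimator is an iteration of itself, so it is a fixed point of the same smooth map that
  -- produces `s'`.
  have e2 : sh = stepMap S q H (p, sh) := (hball (hin sh (by linarith))).1.1 sh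
    (isStep_self hp hp1 hest.1 (hball (hin sh (by linarith))).2)
  have h := hexp p sh s (by linarith) (by linarith) (by linarith)
  rw [← e1, ← e2] at h
  refine h.trans ?_
  have hd : 0 ≤ ‖s - sh‖ := norm_nonneg _
  calc K * (‖p - p₀‖ + ‖sh - s₀‖ + ‖s - sh‖) * ‖s - sh‖
      ≤ K * (‖p - p₀‖ + L * ‖p - p₀‖ + ‖s - sh‖) * ‖s - sh‖ := by gcongr
    _ = K * (L + 1) * (‖p - p₀‖ * ‖s - sh‖) + K * ‖s - sh‖ ^ 2 := by ring
    _ ≤ (K * (L + 1) + L) * (‖p - p₀‖ * ‖s - sh‖) + (K * (L + 1) + L) * ‖s - sh‖ ^ 2 := by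
        have : K ≤ K * (L + 1) + L := by nlinarith
        gcongr
        linarith
    _ = _ := by ring

end Consistency

/-! ### Relative frequencies and their rate of convergence. -/

section Frequencies

variable {Ω : Type*} [MeasurableSpace Ω] {𝒲 : Type*} [Fintype 𝒲] [MeasurableSpace 𝒲]
  [MeasurableSingletonClass 𝒲] {μ : Measure Ω} {W : ℕ → Ω → 𝒲}

/-- The relative frequencies of the values among the first `N` observations. -/
def freq (W : ℕ → Ω → 𝒲) (N : ℕ) (ω : Ω) (w : 𝒲) : ℝ :=
  sampleAvg W N ω (Set.indicator {w} 1)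

/-- The probabilities of the values of one observation. -/
def prob (μ : Measure Ω) (W : ℕ → Ω → 𝒲) (w : 𝒲) : ℝ :=
  popAvg μ W (Set.indicator {w} 1)

omit [MeasurableSpace 𝒲] [MeasurableSingletonClass 𝒲] in
theorem sum_indicator_mul (g : 𝒲 → ℝ) (x : 𝒲) :
    ∑ w, Set.indicator ({w} : Set 𝒲) (1 : 𝒲 → ℝ) x * g w = g x := by
  rw [Finset.sum_eq_single x]
  · simp
  · intro w _ hw
    simp [Set.indicator, Ne.symm hw]
  · simp

omit [MeasurableSpace Ω] [MeasurableSpace 𝒲] [MeasurableSingletonClass 𝒲] in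
-- Group the observations by value. The identity also holds for `N = 0`, where both sides vanish;
-- only the normalization `sum_freq` needs `N ≠ 0`.
theorem sampleAvg_eq_wavg (N : ℕ) (ω : Ω) : sampleAvg W N ω = wavg (freq W N ω) := by
  funext g
  simp only [wavg, freq, sampleAvg, mul_assoc, ← Finset.mul_sum, Finset.sum_mul]
  rw [Finset.sum_comm]
  simp only [sum_indicator_mul]

omit [MeasurableSpace Ω] [MeasurableSpace 𝒲] [MeasurableSingletonClass 𝒲] [Fintype 𝒲] in
theorem freq_nonneg (N : ℕ) (ω : Ω) (w : 𝒲) : 0 ≤ freq W N ω w :=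
  mul_nonneg (by positivity) (Finset.sum_nonneg fun i _ =>
    Set.indicator_nonneg (fun _ _ => zero_le_one) _)

omit [MeasurableSpace Ω] [MeasurableSpace 𝒲] [MeasurableSingletonClass 𝒲] in
theorem sum_freq {N : ℕ} (hN : N ≠ 0) (ω : Ω) : ∑ w, freq W N ω w = 1 := by
  have := congrFun (sampleAvg_eq_wavg (W := W) N ω) (fun _ => 1)
  simp only [wavg, mul_one] at this
  rw [← this]
  have hN' : (N : ℝ) ≠ 0 := Nat.cast_ne_zero.2 hN
  simp [sampleAvg, hN']

omit [MeasurableSpace 𝒲] [MeasurableSingletonClass 𝒲] [Fintype 𝒲] in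
theorem prob_nonneg (w : 𝒲) : 0 ≤ prob μ W w :=
  integral_nonneg fun _ => Set.indicator_nonneg (fun _ _ => zero_le_one) _

omit [Fintype 𝒲] in
theorem aemeasurable_indicator_comp (hident : ∀ i, IdentDistrib (W i) (W 0) μ μ) (i : ℕ) (w : 𝒲) :
    AEMeasurable (fun ω => Set.indicator ({w} : Set 𝒲) (1 : 𝒲 → ℝ) (W i ω)) μ :=
  (measurable_one.indicator (measurableSet_singleton w)).comp_aemeasurable
    (hident i).aemeasurable_fst

omit [Fintype 𝒲] [MeasurableSpace 𝒲] [MeasurableSingletonClass 𝒲] in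
theorem indicator_mem_Icc (w x : 𝒲) :
    Set.indicator ({w} : Set 𝒲) (1 : 𝒲 → ℝ) x ∈ Set.Icc (0 : ℝ) 1 := by
  by_cases h : x = w <;> simp [Set.indicator, h]

omit [Fintype 𝒲] in
theorem memLp_indicator_comp [IsProbabilityMeasure μ]
    (hident : ∀ i, IdentDistrib (W i) (W 0) μ μ) (i : ℕ) (w : 𝒲) (p : ENNReal) :
    MemLp (fun ω => Set.indicator ({w} : Set 𝒲) (1 : 𝒲 → ℝ) (W i ω)) p μ :=
  MemLp.of_bound (aemeasurable_indicator_comp hident i w).aestronglyMeasurable 1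
    (ae_of_all _ fun ω => by
      have := indicator_mem_Icc w (W i ω)
      rw [Real.norm_eq_abs, abs_of_nonneg this.1]
      exact this.2)

theorem popAvg_eq_wavg [IsProbabilityMeasure μ] (hident : ∀ i, IdentDistrib (W i) (W 0) μ μ) :
    popAvg μ W = wavg (prob μ W) := by
  funext g
  simp only [wavg, prob, popAvg, ← integral_mul_const]
  rw [← integral_finsetSum]
  · simp only [sum_indicator_mul]
  · exact fun w _ => ((memLp_indicator_comp hident 0 w 1).integrable le_rfl).mul_const _

omit [Fintype 𝒲] in
/-- Chebyshev's inequality for the relative frequencies. -/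
theorem measure_freq_sub_prob_le [IsProbabilityMeasure μ] (hindep : iIndepFun W μ)
    (hident : ∀ i, IdentDistrib (W i) (W 0) μ μ) {N : ℕ} (hN : 0 < N) {c : ℝ} (hc : 0 < c) (w : 𝒲) :
    μ {ω | c ≤ √(N : ℝ) * |freq W N ω w - prob μ W w|} ≤ ENNReal.ofReal (1 / c ^ 2) := by
  set Y : ℕ → Ω → ℝ := fun i ω => Set.indicator ({w} : Set 𝒲) (1 : 𝒲 → ℝ) (W i ω) with hY
  have hYm : ∀ i, MemLp (Y i) 2 μ := fun i => memLp_indicator_comp hident i w 2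
  have hN' : (0 : ℝ) < N := Nat.cast_pos.2 hN
  have hmeas : Measurable (Set.indicator ({w} : Set 𝒲) (1 : 𝒲 → ℝ)) :=
    measurable_one.indicator (measurableSet_singleton w)
  have hmean : ∀ i, ∫ ω, Y i ω ∂μ = prob μ W w := fun i => ((hident i).comp hmeas).integral_eq
  have hsum : μ[∑ i ∈ Finset.range N, Y i] = N * prob μ W w := by
    simp only [Finset.sum_apply]
    rw [integral_finsetSum _ fun i _ => (hYm i).integrable (by norm_num)]
    simp [hmean]
  -- Independence makes variances add, and a variable in [0, 1] has variance at most 1/4; the cruder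
  -- bound 1 is enough.
  have hvar : variance (∑ i ∈ Finset.range N, Y i) μ ≤ N := by
    rw [IndepFun.variance_sum (fun i _ => hYm i) fun i _ j _ hij =>
      (hindep.indepFun hij).comp hmeas hmeas]
    calc _ ≤ ∑ i ∈ Finset.range N, (1 : ℝ) := Finset.sum_le_sum fun i _ =>
          (variance_le_sq_of_bounded (ae_of_all _ fun ω => indicator_mem_Icc w (W i ω))
            (aemeasurable_indicator_comp hident i w)).trans (by norm_num)
      _ = N := by simp
  have hcN : 0 < c * √(N : ℝ) := by positivity
  have h := meas_ge_le_variance_div_sq (memLp_finsetSum' _ fun i (_ : i ∈ Finset.range N) => hYm i)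
    hcN
  rw [hsum] at h
  refine le_trans (measure_mono fun ω hω => ?_) (h.trans (ENNReal.ofReal_le_ofReal ?_))
  · have hfreq : (∑ i ∈ Finset.range N, Y i) ω - N * prob μ W w =
        N * (freq W N ω w - prob μ W w) := by
      simp only [freq, sampleAvg, Finset.sum_apply, hY]
      field_simp
    have hω' : c ≤ √(N : ℝ) * |freq W N ω w - prob μ W w| := hω
    change c * √(N : ℝ) ≤ |(∑ i ∈ Finset.range N, Y i) ω - N * prob μ W w|
    rw [hfreq, abs_mul, abs_of_pos hN']
    calc c * √(N : ℝ) ≤ √(N : ℝ) * |freq W N ω w - prob μ W w| * √(N : ℝ) := by gcongr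
      _ = (√(N : ℝ) * √(N : ℝ)) * |freq W N ω w - prob μ W w| := by ring
      _ = _ := by rw [Real.mul_self_sqrt hN'.le]
  · rw [mul_pow, Real.sq_sqrt hN'.le, div_le_div_iff₀ (by positivity) (by positivity)]
    nlinarith [sq_nonneg c]

/-- The relative frequencies converge at the rate `N^{-1/2}`. -/
theorem exists_freq_bound [IsProbabilityMeasure μ] (hindep : iIndepFun W μ)
    (hident : ∀ i, IdentDistrib (W i) (W 0) μ μ) {ε : ENNReal} (hε : 0 < ε) :
    ∃ C ≥ 0, ∀ N : ℕ, 0 < N → μ {ω | C * (√(N : ℝ))⁻¹ < ‖freq W N ω - prob μ W‖} ≤ ε := by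
  obtain ⟨e, he, heε⟩ : ∃ e : ℝ, 0 < e ∧ ENNReal.ofReal e ≤ ε := by
    obtain ⟨x, hx0, hx⟩ := ENNReal.lt_iff_exists_nnreal_btwn.1 hε
    exact ⟨x, by exact_mod_cast hx0, by simpa using hx.le⟩
  set n : ℝ := ((Fintype.card 𝒲 : ℕ) : ℝ) with hn
  have hn0 : 0 ≤ n := Nat.cast_nonneg _
  -- The union bound over the `n` values costs `n / C ^ 2`, which is at most `e`; using `n + 1`
  -- keeps `C` positive.
  set C : ℝ := √((n + 1) / e) with hC
  have hCpos : 0 < C := by positivity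
  have hC2 : C ^ 2 = (n + 1) / e := Real.sq_sqrt (by positivity)
  refine ⟨C, hCpos.le, fun N hN => ?_⟩
  have hN' : (0 : ℝ) < N := Nat.cast_pos.2 hN
  calc μ {ω | C * (√(N : ℝ))⁻¹ < ‖freq W N ω - prob μ W‖}
      ≤ μ (⋃ w ∈ (Finset.univ : Finset 𝒲), {ω | C ≤ √(N : ℝ) * |freq W N ω w - prob μ W w|}) := by
        refine measure_mono fun ω hω => ?_
        have hω' : C * (√(N : ℝ))⁻¹ < ‖freq W N ω - prob μ W‖ := hω
        simp only [Set.mem_iUnion, Finset.mem_univ, exists_prop, true_and]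
        by_contra! h
        refine absurd hω' (not_lt.2 ((pi_norm_le_iff_of_nonneg (by positivity)).2 fun w => ?_))
        have hw : √(N : ℝ) * |freq W N ω w - prob μ W w| < C := not_le.1 fun hle => h w hle
        rw [Pi.sub_apply, Real.norm_eq_abs, ← div_eq_mul_inv, le_div_iff₀ (by positivity), mul_comm]
        exact hw.le
    _ ≤ ∑ w : 𝒲, μ {ω | C ≤ √(N : ℝ) * |freq W N ω w - prob μ W w|} :=
        measure_biUnion_finset_le _ _
    _ ≤ ∑ w : 𝒲, ENNReal.ofReal (1 / C ^ 2) :=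
        Finset.sum_le_sum fun w _ => measure_freq_sub_prob_le hindep hident hN hCpos w
    _ = ENNReal.ofReal (n * (1 / C ^ 2)) := by
        rw [Finset.sum_const, Finset.card_univ, nsmul_eq_mul, ENNReal.ofReal_mul hn0, hn,
          ENNReal.ofReal_natCast]
    _ ≤ ENNReal.ofReal e := by
        refine ENNReal.ofReal_le_ofReal ?_
        rw [hC2, one_div_div, mul_div_assoc', div_le_iff₀ (by positivity)]
        nlinarith
    _ ≤ ε := heε

theorem wpa1_iff {p : ℕ → Ω → Prop} :
    WPA1 μ p ↔ ∀ ε : ENNReal, 0 < ε → ∀ᶠ N in atTop, μ {ω | ¬ p N ω} ≤ ε :=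
  ENNReal.tendsto_nhds_zero

end Frequencies

/-! ### From the deterministic expansion to probability bounds. -/

section Main

variable {M d dY J T : ℕ} {X A : Type*} [Fintype X] [Fintype A]
  [MeasurableSpace X] [MeasurableSingletonClass X] [MeasurableSpace A] [MeasurableSingletonClass A]
  {Ω : Type*} [MeasurableSpace Ω] {μ : Measure Ω} [IsProbabilityMeasure μ]
  {S : Model d dY J X A} {q : ℕ∞} {W : ℕ → Ω → Path T J X A} {sStar : State M d dY J X A}
  {sHat : ℕ → Ω → State M d dY J X A}

/-- The estimator is `√N`-consistent, and the expansion of the algorithm holds uniformly near it. -/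
theorem exists_uniform_bound (hindep : iIndepFun W μ) (hident : ∀ i, IdentDistrib (W i) (W 0) μ μ)
    (hfix : SameFixedPoint S q) (hid : Identified S q (popAvg μ W) sStar)
    (hreg : Regular S q (popAvg μ W) sStar)
    (hHat : WPA1 μ fun N ω => IsEstimator S q (sampleAvg W N ω) (sHat N ω) ∧
      ∀ σ, ‖sHat N ω - sStar‖ ≤ ‖relabel σ (sHat N ω) - sStar‖) :
    ∃ r > 0, ∀ ε : ENNReal, 0 < ε → ∃ C ≥ 0, ∀ᶠ N : ℕ in atTop,
      μ {ω | ¬ (‖sHat N ω - sStar‖ ≤ C * (√(N : ℝ))⁻¹ ∧ ∀ s s', ‖s - sHat N ω‖ ≤ r →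
        IsStep S q (sampleAvg W N ω) s s' →
        ‖(s' - sHat N ω) - rateMatrix S q (popAvg μ W) sStar (s - sHat N ω)‖ ≤
          C * ((√(N : ℝ))⁻¹ * ‖s - sHat N ω‖ + ‖s - sHat N ω‖ ^ 2))} ≤ ε := by
  rw [popAvg_eq_wavg hident] at hid hreg ⊢
  obtain ⟨r, hr, K, hK, hev⟩ := exists_uniform_expansion hfix (fun w => prob_nonneg w) hid hreg
  obtain ⟨δ, hδ, hball⟩ := Metric.eventually_nhds_iff.1 hev
  refine ⟨r, hr, fun ε hε => ?_⟩
  obtain ⟨C, hC, hfreq⟩ := exists_freq_bound hindep hident (ENNReal.half_pos hε.ne')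
  refine ⟨K * (C + 1), by positivity, ?_⟩
  have hsmall : ∀ᶠ N : ℕ in atTop, C * (√(N : ℝ))⁻¹ < δ := by
    have : Tendsto (fun N : ℕ => C * (√(N : ℝ))⁻¹) atTop (𝓝 (C * 0)) :=
      (tendsto_inv_atTop_zero.comp
        (Real.tendsto_sqrt_atTop.comp tendsto_natCast_atTop_atTop)).const_mul C
    rw [mul_zero] at this
    exact this.eventually (gt_mem_nhds hδ)
  filter_upwards [hsmall, eventually_gt_atTop 0,
    wpa1_iff.1 hHat _ (ENNReal.half_pos hε.ne')] with N hN hN0 hest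
  -- The bad event is covered by the failure of the estimator and by a large frequency error. Only
  -- monotonicity and subadditivity are used, so no measurability of these events is needed.
  refine le_trans (le_trans (measure_mono fun ω hω => ?_) (measure_union_le _ _))
    ((add_le_add hest (hfreq N hN0)).trans_eq (ENNReal.add_halves ε))
  by_contra hcon
  rw [Set.mem_union, not_or] at hcon
  obtain ⟨h1, h2⟩ := hcon
  have h1' : IsEstimator S q (sampleAvg W N ω) (sHat N ω) ∧
      ∀ σ, ‖sHat N ω - sStar‖ ≤ ‖relabel σ (sHat N ω) - sStar‖ := not_not.1 h1
  have h2' : ‖freq W N ω - prob μ W‖ ≤ C * (√(N : ℝ))⁻¹ := not_lt.1 h2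
  rw [sampleAvg_eq_wavg] at h1'
  obtain ⟨h3, h4⟩ := hball (by rw [dist_eq_norm]; exact h2'.trans_lt hN) (freq_nonneg N ω)
    (sum_freq hN0.ne' ω) _ h1'.1 h1'.2
  have hinv : 0 ≤ (√(N : ℝ))⁻¹ := by positivity
  refine hω ⟨?_, fun s s' hs hstep => ?_⟩
  · calc _ ≤ K * (C * (√(N : ℝ))⁻¹) := h3.trans (by gcongr)
      _ ≤ K * ((C + 1) * (√(N : ℝ))⁻¹) := by gcongr; linarith
      _ = _ := by ring
  · rw [sampleAvg_eq_wavg] at hstep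
    have hd : 0 ≤ ‖s - sHat N ω‖ := norm_nonneg _
    calc _ ≤ K * (C * (√(N : ℝ))⁻¹ * ‖s - sHat N ω‖ + 1 * ‖s - sHat N ω‖ ^ 2) := by
          rw [one_mul]
          exact (h4 s s' hs hstep).trans (by gcongr)
      _ ≤ K * ((C + 1) * (√(N : ℝ))⁻¹ * ‖s - sHat N ω‖ + (C + 1) * ‖s - sHat N ω‖ ^ 2) := by
          gcongr <;> linarith
      _ = _ := by ring

end Main

end EMNPL

end

/-! ### The expansion near the estimator and along the iterates. -/

theorem mainTheorem4 {M d dY J T : ℕ} {X A : Type*} [Fintype X] [Fintype A]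
    [MeasurableSpace X] [MeasurableSingletonClass X]
    [MeasurableSpace A] [MeasurableSingletonClass A]
    {Ω : Type*} [MeasurableSpace Ω] (μ : Measure Ω) [IsProbabilityMeasure μ]
    (S : EMNPL.Model d dY J X A) (q : ℕ∞) (hq : 1 ≤ q)
    -- i.i.d. markets
    (W : ℕ → Ω → EMNPL.Path T J X A)
    (hindep : iIndepFun W μ) (hident : ∀ i, IdentDistrib (W i) (W 0) μ μ)
    -- the population fixed point `(π*, θ*, Y*, P*)`
    (sStar : EMNPL.State M d dY J X A)
    (hfix : EMNPL.SameFixedPoint S q)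
    (hident' : EMNPL.Identified S q (EMNPL.popAvg μ W) sStar)
    (hreg : EMNPL.Regular S q (EMNPL.popAvg μ W) sStar)
    -- the estimator, with its types labelled as closely as possible to those of `sStar`
    (sHat : ℕ → Ω → EMNPL.State M d dY J X A)
    (hHat : EMNPL.WPA1 μ fun N ω => EMNPL.IsEstimator S q (EMNPL.sampleAvg W N ω) (sHat N ω) ∧
      ∀ σ, ‖sHat N ω - sStar‖ ≤ ‖EMNPL.relabel σ (sHat N ω) - sStar‖) :
    -- one step of the algorithm, uniformly over the states near the estimator
    (∃ r > 0, ∀ ε : ENNReal, 0 < ε → ∃ C : ℝ, ∀ᶠ N : ℕ in atTop,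
      μ {ω | ∃ s s' : EMNPL.State M d dY J X A, ‖s - sHat N ω‖ ≤ r ∧
        EMNPL.IsStep S q (EMNPL.sampleAvg W N ω) s s' ∧
        C * ((√(N : ℝ))⁻¹ * ‖s - sHat N ω‖ + ‖s - sHat N ω‖ ^ 2) <
          ‖(s' - sHat N ω) -
            EMNPL.rateMatrix S q (EMNPL.popAvg μ W) sStar (s - sHat N ω)‖} ≤ ε) ∧
    -- every iteration of the algorithm, started from consistent initial values
    (∀ iter : ℕ → ℕ → Ω → EMNPL.State M d dY J X A,
      TendstoInMeasure μ (fun N ω => iter N 0 ω) atTop (fun _ => sStar) →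
      (∀ k, EMNPL.WPA1 μ fun N ω =>
        EMNPL.IsStep S q (EMNPL.sampleAvg W N ω) (iter N k ω) (iter N (k + 1) ω)) →
      ∀ k, EMNPL.IsBigOp μ
        (fun N ω => (iter N (k + 1) ω - sHat N ω) -
          EMNPL.rateMatrix S q (EMNPL.popAvg μ W) sStar (iter N k ω - sHat N ω))
        (fun N ω => (√(N : ℝ))⁻¹ * ‖iter N k ω - sHat N ω‖ + ‖iter N k ω - sHat N ω‖ ^ 2)) := by
  obtain ⟨r, hr, hgood⟩ := EMNPL.exists_uniform_bound hindep hident hfix hident' hreg hHat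
  set R := EMNPL.rateMatrix S q (EMNPL.popAvg μ W) sStar with hR
  refine ⟨⟨r, hr, fun ε hε => ?_⟩, fun iter hinit hstep => ?_⟩
  · obtain ⟨C, -, hC⟩ := hgood ε hε
    refine ⟨C, hC.mono fun N hN => (measure_mono ?_).trans hN⟩
    rintro ω ⟨s, s', hs, hss', hlt⟩ hω
    exact absurd (hω.2 s s' hs hss') (not_le.2 hlt)
  have hthird : ∀ ε : ENNReal, 0 < ε → 0 < ε / 3 := fun ε hε =>
    ENNReal.div_pos hε.ne' (by norm_num)
  have hsmall : ∀ C η : ℝ, 0 < η → ∀ᶠ N : ℕ in atTop, C * (√(N : ℝ))⁻¹ < η := fun C η hη => by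
    have : Tendsto (fun N : ℕ => C * (√(N : ℝ))⁻¹) atTop (𝓝 (C * 0)) :=
      (tendsto_inv_atTop_zero.comp
        (Real.tendsto_sqrt_atTop.comp tendsto_natCast_atTop_atTop)).const_mul C
    rw [mul_zero] at this
    exact this.eventually (gt_mem_nhds hη)
  -- The uniform expansion applies only within distance `r` of the estimator, so each fixed iterate
  -- must first be shown to be consistent.
  have hcons : ∀ k, ∀ η : ℝ, 0 < η → EMNPL.WPA1 μ fun N ω => ‖iter N k ω - sHat N ω‖ < η := by
    intro k
    induction k with
    | zero =>
      intro η hη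
      rw [EMNPL.wpa1_iff]
      intro ε hε
      obtain ⟨C, hC0, hC⟩ := hgood _ (ENNReal.half_pos hε.ne')
      have h0 := ENNReal.tendsto_nhds_zero.1
        (tendstoInMeasure_iff_norm.1 hinit (η / 2) (by positivity)) _ (ENNReal.half_pos hε.ne')
      filter_upwards [hC, h0, hsmall C (η / 2) (by positivity)] with N h1 h2 h3
      refine le_trans (le_trans (measure_mono fun ω hω => ?_) (measure_union_le _ _))
        ((add_le_add h1 h2).trans_eq (ENNReal.add_halves ε))
      by_contra hcon
      rw [Set.mem_union, not_or] at hcon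
      have h4 := (not_not.1 hcon.1).1
      have h5 : ‖iter N 0 ω - sStar‖ < η / 2 := not_le.1 hcon.2
      refine hω ?_
      calc ‖iter N 0 ω - sHat N ω‖ = ‖(iter N 0 ω - sStar) - (sHat N ω - sStar)‖ := by
            congr 1; abel
        _ ≤ ‖iter N 0 ω - sStar‖ + ‖sHat N ω - sStar‖ := norm_sub_le _ _
        _ < η := by linarith
    | succ k ih =>
      intro η hη
      rw [EMNPL.wpa1_iff]
      intro ε hε
      obtain ⟨C, hC0, hC⟩ := hgood _ (hthird ε hε)
      -- Once the error and `N^{-1/2}` are at most 1, one iteration multiplies the error by at most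
      -- `‖R‖ + 2 * C`; the last 1 makes `κ` positive. No contraction is needed because `k` is
      -- fixed.
      set κ : ℝ := ‖R‖ + C * (1 + 1) + 1 with hκ
      have hκ0 : 0 < κ := by positivity
      set δ : ℝ := min r (min 1 (η / κ)) with hδ
      have hδ0 : 0 < δ := by positivity
      filter_upwards [hC, EMNPL.wpa1_iff.1 (hstep k) _ (hthird ε hε),
        EMNPL.wpa1_iff.1 (ih δ hδ0) _ (hthird ε hε), hsmall 1 1 one_pos] with N h1 h2 h3 h4
      refine le_trans (le_trans (measure_mono fun ω hω => ?_) ((measure_union_le _ _).trans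
        (add_le_add_left (measure_union_le _ _) _))) ((add_le_add (add_le_add h1 h2) h3).trans_eq
        (ENNReal.add_thirds ε))
      by_contra hcon
      rw [Set.mem_union, Set.mem_union, not_or, not_or] at hcon
      obtain ⟨⟨g1, g2⟩, g3⟩ := hcon
      have g3' : ‖iter N k ω - sHat N ω‖ < δ := not_not.1 g3
      have hx := (not_not.1 g1).2 _ _ (g3'.le.trans (min_le_left _ _)) (not_not.1 g2)
      set x := ‖iter N k ω - sHat N ω‖
      have hx0 : 0 ≤ x := norm_nonneg _
      have hx1 : x ≤ 1 := g3'.le.trans ((min_le_right _ _).trans (min_le_left _ _))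
      have hxη : x < η / κ := g3'.trans_le ((min_le_right _ _).trans (min_le_right _ _))
      refine hω ?_
      calc ‖iter N (k + 1) ω - sHat N ω‖
          = ‖((iter N (k + 1) ω - sHat N ω) - R (iter N k ω - sHat N ω)) +
              R (iter N k ω - sHat N ω)‖ := by congr 1; abel
        _ ≤ C * ((√(N : ℝ))⁻¹ * x + x ^ 2) + ‖R‖ * x :=
            (norm_add_le _ _).trans (add_le_add hx (R.le_opNorm _))
        _ ≤ C * (1 * x + 1 * x) + ‖R‖ * x := by
            rw [one_mul] at h4
            rw [sq]
            gcongr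
        _ ≤ κ * x := by rw [hκ]; nlinarith
        _ < η := by rwa [lt_div_iff₀ hκ0, mul_comm] at hxη
  intro k ε hε
  obtain ⟨C, hC0, hC⟩ := hgood _ (hthird ε hε)
  refine ⟨C, ?_⟩
  filter_upwards [hC, EMNPL.wpa1_iff.1 (hstep k) _ (hthird ε hε),
    EMNPL.wpa1_iff.1 (hcons k r hr) _ (hthird ε hε)] with N h1 h2 h3
  refine le_trans (le_trans (measure_mono fun ω hω => ?_) ((measure_union_le _ _).trans
    (add_le_add_left (measure_union_le _ _) _))) ((add_le_add (add_le_add h1 h2) h3).trans_eq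
    (ENNReal.add_thirds ε))
  by_contra hcon
  rw [Set.mem_union, Set.mem_union, not_or, not_or] at hcon
  obtain ⟨⟨g1, g2⟩, g3⟩ := hcon
  have g3' : ‖iter N k ω - sHat N ω‖ < r := not_not.1 g3
  exact absurd ((not_not.1 g1).2 _ _ g3'.le (not_not.1 g2)) (not_le.2 hω)
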